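/- Fix an o-minimal structure $\mathcal D$ expanding the real field; "definable" means definable in $\mathcal D$. Let $M\subset\mathbb R^n$ be a closed definable $C^2$ submanifold and let $(U,r)$ be a definable tubular neighbourhood of $M$: $U$ is a definable neighbourhood of $M$ in $\mathbb R^n$ and $r:U\to M$ is a definable retraction such that, for every $x\in U$, $r(x)$ is the unique point of $M$ realizing the Euclidean distance from $x$ to $M$. For a $C^1$ map $f:N\to\mathbb R^n$ on a submanifold $N\subset\mathbb R^n$, let $|f|_1$ be the function on $N$ given by $|f|_1(x)=|f(x)|+|d_xf|$, where $|d_xf|$ is the operator norm of $d_xf:T_xN\to\mathbb R^n$ for the Euclidean norm. Then there is a positive definable continuous function $\varepsilon:\mathbb R^n\to\mathbb R$ with the following property. Let $N\subset\mathbb R^n$ be any definable $C^2$ submanifold for which there is a $C^1$ diffeomorphism $h:N\to M$ (not assumed definable) with $|h-\mathrm{id}_N|_1(x)<\varepsilon(x)$ for all $x\in N$. Then $N\subset U$, and the restriction $r|_N:N\to M$ is a definable $C^1$ diffeomorphism. If moreover $M$ and $N$ are $C^\infty$ submanifolds, then $r|_N:N\to M$ is a definable $C^\infty$ diffeomorphism.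 -/

import Mathlib

open Set Topology
open scoped ContDiff

/-- An o-minimal structure expanding the real field `(ℝ, +, ·)`: for every `n` a Boolean algebra
`sets n` of subsets of `ℝⁿ` containing the algebraic sets, stable under products and projections,
and such that `sets 1` consists exactly of the finite unions of points and intervals. -/
structure OMinimalStructure where
  /-- The sets of `ℝⁿ` that belong to the structure. -/
  sets : (n : ℕ) → Set (Set (Fin n → ℝ))
  empty_mem : ∀ n : ℕ, (∅ : Set (Fin n → ℝ)) ∈ sets n
  compl_mem : ∀ (n : ℕ) (A : Set (Fin n → ℝ)), A ∈ sets n → Aᶜ ∈ sets n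
  union_mem : ∀ (n : ℕ) (A B : Set (Fin n → ℝ)), A ∈ sets n → B ∈ sets n → A ∪ B ∈ sets n
  /-- Real algebraic sets belong to the structure. (Every real algebraic set is a finite
  intersection of zero sets of single polynomials.) -/
  algebraic_mem : ∀ (n : ℕ) (p : MvPolynomial (Fin n) ℝ),
    {x : Fin n → ℝ | MvPolynomial.eval x p = 0} ∈ sets n
  /-- The product `A × B ⊆ ℝᵐ⁺ⁿ`. -/
  prod_mem : ∀ (m n : ℕ) (A : Set (Fin m → ℝ)) (B : Set (Fin n → ℝ)), A ∈ sets m → B ∈ sets n →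
    {z : Fin (m + n) → ℝ | (fun i => z (Fin.castAdd n i)) ∈ A ∧
      (fun j => z (Fin.natAdd m j)) ∈ B} ∈ sets (m + n)
  /-- The image under the projection `ℝⁿ × ℝ → ℝⁿ` forgetting the last coordinate. -/
  proj_mem : ∀ (n : ℕ) (A : Set (Fin (n + 1) → ℝ)), A ∈ sets (n + 1) →
    (fun (z : Fin (n + 1) → ℝ) (i : Fin n) => z i.castSucc) '' A ∈ sets n
  /-- `sets 1` consists of the finite unions of points and intervals; the order-connected subsets
  of `ℝ` are the intervals of all kinds, bounded or not, including points and `∅`. -/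
  mem_one_iff : ∀ A : Set (Fin 1 → ℝ), A ∈ sets 1 ↔
    ∃ F : Set (Set ℝ), F.Finite ∧ (∀ I ∈ F, I.OrdConnected) ∧
      {t : ℝ | (fun _ : Fin 1 => t) ∈ A} = ⋃₀ F

namespace OMinimalStructure

/-- A subset of Euclidean space is definable if it belongs to the structure. -/
def IsDefinable (D : OMinimalStructure) {n : ℕ} (A : Set (EuclideanSpace ℝ (Fin n))) : Prop :=
  {v : Fin n → ℝ | WithLp.toLp 2 v ∈ A} ∈ D.sets n

/-- The mapping `f : A → ℝᵏ`, `A ⊆ ℝⁿ`, is definable: its graph, as a subset of `ℝⁿ⁺ᵏ`, belongs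
to the structure. -/
def IsDefinableMapOn (D : OMinimalStructure) {n k : ℕ}
    (f : EuclideanSpace ℝ (Fin n) → EuclideanSpace ℝ (Fin k))
    (A : Set (EuclideanSpace ℝ (Fin n))) : Prop :=
  {z : Fin (n + k) → ℝ | ∃ x ∈ A, z = Fin.append (WithLp.ofLp x) (WithLp.ofLp (f x))} ∈
    D.sets (n + k)

/-- The set `𝒟⁺(A)` of positive definable continuous functions on `A ⊆ ℝⁿ`. -/
def posFun (D : OMinimalStructure) {n : ℕ} (A : Set (EuclideanSpace ℝ (Fin n))) :
    Set (EuclideanSpace ℝ (Fin n) → ℝ) :=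
  {ε | (∀ x ∈ A, 0 < ε x) ∧ ContinuousOn ε A ∧
    {z : Fin (n + 1) → ℝ | ∃ x ∈ A, z = Fin.append (WithLp.ofLp x) (fun _ : Fin 1 => ε x)} ∈
      D.sets (n + 1)}

/-- `(U, r)` is a definable tubular neighborhood of `M`: `U` is a definable neighborhood of `M`
and `r : U → M` is a definable retraction such that for every `x ∈ U`, `r x` is the (unique) point
of `M` that realizes the distance from `x` to `M`. -/
structure IsTubularNeighborhood (D : OMinimalStructure) {n : ℕ}
    (M U : Set (EuclideanSpace ℝ (Fin n)))
    (r : EuclideanSpace ℝ (Fin n) → EuclideanSpace ℝ (Fin n)) : Prop where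
  definable_nhd : D.IsDefinable U
  mem_nhdsSet : U ∈ 𝓝ˢ M
  definable_map : D.IsDefinableMapOn r U
  continuousOn : ContinuousOn r U
  mapsTo : MapsTo r U M
  id_on : ∀ x ∈ M, r x = x
  nearest : ∀ x ∈ U, ∀ y ∈ M, y ≠ r x → dist x (r x) < dist x y

end OMinimalStructure

/-- `M` is a (`C^p`, embedded) submanifold of `ℝⁿ`: for some `m ≤ n`, around each point of `M`
there is a `C^p` diffeomorphism between open subsets of `ℝⁿ` that straightens `M` to
`ℝᵐ × {0}`. -/
def IsSubmanifold {n : ℕ} (p : WithTop ℕ∞) (M : Set (EuclideanSpace ℝ (Fin n))) : Prop :=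
  ∃ m : ℕ, m ≤ n ∧ ∀ x ∈ M,
    ∃ Φ : OpenPartialHomeomorph (EuclideanSpace ℝ (Fin n)) (EuclideanSpace ℝ (Fin n)),
      x ∈ Φ.source ∧ ContDiffOn ℝ p Φ Φ.source ∧ ContDiffOn ℝ p Φ.symm Φ.target ∧
        ∀ y ∈ Φ.source, y ∈ M ↔ ∀ i : Fin n, m ≤ (i : ℕ) → Φ y i = 0

/-- `f` restricts to a `C^k` diffeomorphism from `A` onto `B`. When `A` and `B` are submanifolds of
class at least `C^k`, `ContDiffOn` on them is `C^k` smoothness in the sense of submanifolds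
(equivalently, in local charts, or by local `C^k` extension to the ambient space). -/
def IsDiffeo {n : ℕ} (k : WithTop ℕ∞)
    (f : EuclideanSpace ℝ (Fin n) → EuclideanSpace ℝ (Fin n))
    (A B : Set (EuclideanSpace ℝ (Fin n))) : Prop :=
  BijOn f A B ∧ ContDiffOn ℝ k f A ∧
    ∃ g : EuclideanSpace ℝ (Fin n) → EuclideanSpace ℝ (Fin n),
      ContDiffOn ℝ k g B ∧ LeftInvOn g f A

/-- The tangent space `T_x N`. For a submanifold `N` of class `C¹`, the tangent cone over `ℝ` is
already the tangent space, and the span only serves to have it as a subspace. -/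
noncomputable def tangentSpaceAt {n : ℕ} (N : Set (EuclideanSpace ℝ (Fin n)))
    (x : EuclideanSpace ℝ (Fin n)) : Submodule ℝ (EuclideanSpace ℝ (Fin n)) :=
  Submodule.span ℝ (tangentConeAt ℝ N x)

/-- The derivative `d_x f : T_x N → ℝⁿ` of a map `f : N → ℝⁿ` differentiable at `x`. (Any two
derivatives of `f` within `N` at `x` agree on `T_x N`.) -/
noncomputable def derivOn {n : ℕ} (f : EuclideanSpace ℝ (Fin n) → EuclideanSpace ℝ (Fin n))
    (N : Set (EuclideanSpace ℝ (Fin n))) (x : EuclideanSpace ℝ (Fin n)) :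
    tangentSpaceAt N x →L[ℝ] EuclideanSpace ℝ (Fin n) :=
  (fderivWithin ℝ f N x).comp (tangentSpaceAt N x).subtypeL

/-- The function `|f|₁ = |f| + |df|` on `N`, where `|d_x f|` is the operator norm on `T_x N` for the
Euclidean norm. -/
noncomputable def c1Size {n : ℕ} (f : EuclideanSpace ℝ (Fin n) → EuclideanSpace ℝ (Fin n))
    (N : Set (EuclideanSpace ℝ (Fin n))) (x : EuclideanSpace ℝ (Fin n)) : ℝ :=
  ‖f x‖ + ‖derivOn f N x‖

/-!
Let `k : M → N` be the inverse of the given map `h`, and let `g = r ∘ k : M → M`. For `N` close to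
`M`, the map `g` is close to the identity in the Lipschitz sense, hence bijective, and so is `r|_N`.
What has to be arranged is that "close" is measured by a definable function, although the
hypotheses on `N` and `h` are not first-order and Mathlib knows no o-minimality.

* **The size function.** `AlmostLinearOn U r B` is a first-order substitute for "`r` is `C¹` with
  nearly constant derivative on `B`". For every `x`, let `δ x` be the supremum of the `t ≤ 1` such
  that `r` is almost linear on the ball of radius `t` about each point of `M` within `t` of `x`.
  This function is positive, definable and, by the triangle inequality, `1`-Lipschitz
  (`exists_definable_radius`), so `ε = δ / 100` is a legitimate choice. Definability is obtained by
  writing the condition as a formula (`DefinableSet` and its closure properties); cell decomposition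
  is not used.
* **Regularity of `r`.** By the inverse function theorem applied to the critical point equation of
  the distance, `r` is `C^q` at `x` as soon as the squared distance from `x` to the points of a
  `C^{q+1}` submanifold `M` grows quadratically away from `r x` (`contDiffAt_nearestPoint`). At
  points of `M` this is obvious, whence almost linearity near each point of `M`. Conversely, where
  `r` is Lipschitz the nearest point property alone gives quadratic growth
  (`quadratic_growth_of_lipschitz`). Thus almost linearity, which is definable, implies smoothness
  of every order that `M` allows, which is not a definable condition.
* **Bijectivity.** The bound on `d(h - id)` shows that `k - id` has a small Lipschitz constant on
  balls, since points of `M` are joined in `M` by images under `r` of segments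
  (`norm_inverse_sub_id_sub_le`). Hence so has `g - id` (`norm_comp_sub_sub_le`), which gives
  injectivity (`injOn_comp`) and, by minimizing `‖g y - z‖` over a compact piece of `M` and
  improving with a Newton step, surjectivity (`surjOn_comp`).
* **The inverse.** In local parameters `r|_N` is smooth and expands distances up to a constant, so
  its derivative is injective; the dimensions of `M` and `N` agree because `h` and `k` expand
  distances up to constants, too; the inverse function theorem concludes
  (`IsNearIdentity.isDiffeo`).
-/

/-! ### Definable sets and first-order formulas -/

namespace OMinimalStructure

variable (D : OMinimalStructure)

theorem univ_mem (n : ℕ) : (univ : Set (Fin n → ℝ)) ∈ D.sets n := by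
  simpa using D.compl_mem n ∅ (D.empty_mem n)

theorem inter_mem {n : ℕ} {A B : Set (Fin n → ℝ)} (hA : A ∈ D.sets n) (hB : B ∈ D.sets n) :
    A ∩ B ∈ D.sets n := by
  have := D.compl_mem n _ (D.union_mem n _ _ (D.compl_mem n _ hA) (D.compl_mem n _ hB))
  rwa [compl_union, compl_compl, compl_compl] at this

theorem iInter_mem {n k : ℕ} (A : Fin k → Set (Fin n → ℝ)) (hA : ∀ i, A i ∈ D.sets n) :
    (⋂ i, A i) ∈ D.sets n := by
  induction k with
  | zero => simpa using D.univ_mem n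
  | succ k ih =>
    have : (⋂ i, A i) = A 0 ∩ ⋂ i : Fin k, A i.succ := by
      ext z; simp [Fin.forall_fin_succ]
    rw [this]
    exact D.inter_mem (hA 0) (ih _ fun i => hA _)

theorem image_castAdd_mem {n k : ℕ} {A : Set (Fin (n + k) → ℝ)} (hA : A ∈ D.sets (n + k)) :
    (fun (z : Fin (n + k) → ℝ) (i : Fin n) => z (Fin.castAdd k i)) '' A ∈ D.sets n := by
  induction k with
  | zero => simpa using hA
  | succ k ih =>
    have h1 := ih (D.proj_mem (n + k) A hA)
    rw [image_image] at h1
    exact h1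

/-- Strict positivity of a polynomial is expressed by `∃ s, s² p = 1`. -/
theorem polynomial_pos_mem {n : ℕ} (p : MvPolynomial (Fin n) ℝ) :
    {z : Fin n → ℝ | 0 < MvPolynomial.eval z p} ∈ D.sets n := by
  have h := D.proj_mem n _ (D.algebraic_mem (n + 1)
    (MvPolynomial.X (Fin.last n) ^ 2 * MvPolynomial.rename Fin.castSucc p - 1))
  convert h using 1
  ext z
  simp only [mem_ofPred_eq, mem_image, map_sub, map_mul, map_pow, MvPolynomial.eval_X, map_one,
    MvPolynomial.eval_rename]
  constructor
  · intro hz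
    refine ⟨Fin.snoc z (Real.sqrt (MvPolynomial.eval z p))⁻¹, ?_, ?_⟩
    · have : (Fin.snoc z (Real.sqrt (MvPolynomial.eval z p))⁻¹ : Fin (n + 1) → ℝ) ∘ Fin.castSucc
          = z := by
        ext i; simp
      rw [this]
      simp [Real.sq_sqrt hz.le, hz.ne']
    · ext i; simp
  · rintro ⟨w, hw, rfl⟩
    have hw' : w (Fin.last n) ^ 2 * MvPolynomial.eval (w ∘ Fin.castSucc) p = 1 := by linarith
    by_contra hneg
    have h0 : MvPolynomial.eval (w ∘ Fin.castSucc) p ≤ 0 := not_lt.mp hneg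
    nlinarith [sq_nonneg (w (Fin.last n))]

theorem exists_polynomial_of_linear {n : ℕ} (f : (Fin n → ℝ) →ₗ[ℝ] ℝ) :
    ∃ p : MvPolynomial (Fin n) ℝ, ∀ z, MvPolynomial.eval z p = f z := by
  refine ⟨∑ i, MvPolynomial.C (f (Pi.single i 1)) * MvPolynomial.X i, fun z => ?_⟩
  have : z = ∑ i, z i • (Pi.single i (1 : ℝ) : Fin n → ℝ) := by
    ext j; simp [Finset.sum_apply, Pi.single_apply]
  conv_rhs => rw [this]
  simp [map_sum, mul_comm]

theorem linear_preimage_mem {n k : ℕ} {A : Set (Fin k → ℝ)} (hA : A ∈ D.sets k)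
    (f : (Fin n → ℝ) →ₗ[ℝ] (Fin k → ℝ)) : f ⁻¹' A ∈ D.sets n := by
  choose p hp using fun j : Fin k => exists_polynomial_of_linear ((LinearMap.proj j).comp f)
  have hgr := D.iInter_mem (n := n + k) _ fun j : Fin k => D.algebraic_mem (n + k)
    (MvPolynomial.X (Fin.natAdd n j) - MvPolynomial.rename (Fin.castAdd k) (p j))
  have h := D.image_castAdd_mem (D.inter_mem (D.prod_mem n k univ A (D.univ_mem n) hA) hgr)
  convert h using 1
  ext z
  simp only [mem_preimage, mem_image, mem_inter_iff, mem_ofPred_eq, mem_univ, true_and, mem_iInter,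
    map_sub, MvPolynomial.eval_X, MvPolynomial.eval_rename, hp]
  constructor
  · intro hz
    refine ⟨Fin.append z (f z), ⟨by simpa using hz, fun j => ?_⟩, by ext i; simp⟩
    have : (Fin.append z (f z)) ∘ Fin.castAdd k = z := by ext i; simp
    simp [this]
  · rintro ⟨w, ⟨hw, hj⟩, rfl⟩
    have : f (w ∘ Fin.castAdd k) = fun j => w (Fin.natAdd n j) := by
      ext j
      have := hj j
      simp only [LinearMap.comp_apply, LinearMap.proj_apply] at this
      linarith
    change f (w ∘ Fin.castAdd k) ∈ A
    rwa [this]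

section DefinableSet

variable {X Y : Type*} [AddCommGroup X] [Module ℝ X] [AddCommGroup Y] [Module ℝ Y]

/-- Definable subsets of a real vector space `X`: those whose preimage under every linear map
`ℝⁿ → X` belongs to the structure. For finite-dimensional `X` it is enough to ask this of one
coordinate system; the present form makes stability under linear preimages immediate. -/
def DefinableSet (S : Set X) : Prop :=
  ∀ (n : ℕ) (f : (Fin n → ℝ) →ₗ[ℝ] X), f ⁻¹' S ∈ D.sets n

variable {D}

theorem DefinableSet.compl {S : Set X} (hS : D.DefinableSet S) : D.DefinableSet Sᶜ :=
  fun n f => D.compl_mem n _ (hS n f)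

theorem DefinableSet.inter {S T : Set X} (hS : D.DefinableSet S) (hT : D.DefinableSet T) :
    D.DefinableSet (S ∩ T) :=
  fun n f => D.inter_mem (hS n f) (hT n f)

theorem DefinableSet.and {P Q : X → Prop} (hP : D.DefinableSet {x | P x})
    (hQ : D.DefinableSet {x | Q x}) : D.DefinableSet {x | P x ∧ Q x} :=
  hP.inter hQ

theorem DefinableSet.imp {P Q : X → Prop} (hP : D.DefinableSet {x | P x})
    (hQ : D.DefinableSet {x | Q x}) : D.DefinableSet {x | P x → Q x} := by
  convert (hP.inter hQ.compl).compl using 1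
  ext x; simp

theorem DefinableSet.preimage {S : Set Y} (hS : D.DefinableSet S) {f : X → Y}
    (hf : IsLinearMap ℝ f) : D.DefinableSet {x | f x ∈ S} :=
  fun n l => hS n ((hf.mk' f).comp l)

theorem DefinableSet.exists [FiniteDimensional ℝ Y] {P : X → Y → Prop}
    (hP : D.DefinableSet {q : X × Y | P q.1 q.2}) : D.DefinableSet {x | ∃ y, P x y} := by
  intro n f
  have e : Y ≃ₗ[ℝ] (Fin (Module.finrank ℝ Y) → ℝ) := (Module.finBasis ℝ Y).equivFun
  set k := Module.finrank ℝ Y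
  let F : (Fin (n + k) → ℝ) →ₗ[ℝ] X × Y :=
    (f.comp (LinearMap.funLeft ℝ ℝ (Fin.castAdd k))).prod
      (e.symm.toLinearMap.comp (LinearMap.funLeft ℝ ℝ (Fin.natAdd n)))
  have h := D.image_castAdd_mem (hP _ F)
  convert h using 1
  ext z
  simp only [mem_preimage, mem_ofPred_eq, mem_image]
  constructor
  · rintro ⟨y, hy⟩
    refine ⟨Fin.append z (e y), ?_, by ext i; simp⟩
    have h1 : LinearMap.funLeft ℝ ℝ (Fin.castAdd k) (Fin.append z (e y)) = z := by
      ext i; simp [LinearMap.funLeft_apply]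
    have h2 : LinearMap.funLeft ℝ ℝ (Fin.natAdd n) (Fin.append z (e y)) = e y := by
      ext i; simp [LinearMap.funLeft_apply]
    simpa [F, h1, h2] using hy
  · rintro ⟨w, hw, rfl⟩
    exact ⟨_, hw⟩

theorem DefinableSet.forall [FiniteDimensional ℝ Y] {P : X → Y → Prop}
    (hP : D.DefinableSet {q : X × Y | P q.1 q.2}) : D.DefinableSet {x | ∀ y, P x y} := by
  have := (DefinableSet.exists (P := fun x y => ¬ P x y) hP.compl).compl
  convert this using 1
  ext x; simp

end DefinableSet

section Atoms

variable {D} {n k : ℕ}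

theorem IsDefinable.definableSet {A : Set (EuclideanSpace ℝ (Fin n))} (hA : D.IsDefinable A) :
    D.DefinableSet A := fun _ f =>
  D.linear_preimage_mem hA ((WithLp.linearEquiv 2 ℝ (Fin n → ℝ)).toLinearMap.comp f)

theorem IsDefinableMapOn.definableSet
    {f : EuclideanSpace ℝ (Fin n) → EuclideanSpace ℝ (Fin k)} {A : Set (EuclideanSpace ℝ (Fin n))}
    (hf : D.IsDefinableMapOn f A) :
    D.DefinableSet {q : EuclideanSpace ℝ (Fin n) × EuclideanSpace ℝ (Fin k) |
      q.1 ∈ A ∧ q.2 = f q.1} := by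
  intro _ l
  let F : _ →ₗ[ℝ] (Fin (n + k) → ℝ) :=
    { toFun := fun z => Fin.append (WithLp.ofLp (l z).1) (WithLp.ofLp (l z).2)
      map_add' := fun z w => by
        ext i; refine Fin.addCases (fun i => ?_) (fun i => ?_) i <;> simp
      map_smul' := fun c z => by
        ext i; refine Fin.addCases (fun i => ?_) (fun i => ?_) i <;> simp }
  convert D.linear_preimage_mem hf F using 1
  ext z
  simp only [mem_preimage, mem_ofPred_eq, F, LinearMap.coe_mk, AddHom.coe_mk]
  constructor
  · rintro ⟨h1, h2⟩
    exact ⟨_, h1, by rw [h2]⟩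
  · rintro ⟨x, hx, h⟩
    have h1 : (l z).1 = x := by
      ext i; simpa using congrFun h (Fin.castAdd k i)
    have h2 : (l z).2 = f x := by
      ext i; simpa using congrFun h (Fin.natAdd n i)
    exact ⟨h1 ▸ hx, h1 ▸ h2⟩

/-- The norm comparison `a ‖u‖² < b ‖v‖²` is polynomial, hence definable. -/
theorem definableSet_normSq_lt (a b : ℝ) :
    D.DefinableSet {q : EuclideanSpace ℝ (Fin n) × EuclideanSpace ℝ (Fin k) |
      a * ‖q.1‖ ^ 2 < b * ‖q.2‖ ^ 2} := by
  intro m f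
  choose p hp using fun i : Fin n => exists_polynomial_of_linear
    ((EuclideanSpace.proj i).toLinearMap.comp ((LinearMap.fst ℝ _ _).comp f))
  choose s hs using fun i : Fin k => exists_polynomial_of_linear
    ((EuclideanSpace.proj i).toLinearMap.comp ((LinearMap.snd ℝ _ _).comp f))
  convert D.polynomial_pos_mem (MvPolynomial.C b * (∑ i, s i ^ 2) -
    MvPolynomial.C a * (∑ i, p i ^ 2)) using 1
  ext z
  simp [hp, hs, EuclideanSpace.norm_sq_eq]

theorem definableSet_linear_pos {X : Type*} [AddCommGroup X] [Module ℝ X] {l : X → ℝ}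
    (hl : IsLinearMap ℝ l) (c : ℝ) : D.DefinableSet {x | c < l x} := by
  intro m f
  obtain ⟨p, hp⟩ := exists_polynomial_of_linear ((hl.mk' l).comp f)
  convert D.polynomial_pos_mem (p - MvPolynomial.C c) using 1
  ext z
  simp [hp]

theorem definableSet_norm_le {c : ℝ} (hc : 0 ≤ c) :
    D.DefinableSet {q : EuclideanSpace ℝ (Fin n) × EuclideanSpace ℝ (Fin k) |
      ‖q.1‖ ≤ c * ‖q.2‖} := by
  convert (definableSet_normSq_lt (D := D) (n := k) (k := n) (c ^ 2) 1 |>.preimage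
    (f := fun q : EuclideanSpace ℝ (Fin n) × EuclideanSpace ℝ (Fin k) => (q.2, q.1))
    ⟨fun _ _ => rfl, fun _ _ => rfl⟩).compl using 1
  ext q
  simp only [mem_ofPred_eq, mem_compl_iff, not_lt, one_mul]
  rw [← mul_pow, sq_le_sq₀ (norm_nonneg _) (by positivity)]

theorem definableSet_norm_lt :
    D.DefinableSet {q : EuclideanSpace ℝ (Fin n) × ℝ | ‖q.1‖ < q.2} := by
  have h1 := (definableSet_normSq_lt (D := D) (n := n) (k := 1) 1 1).preimage
    (f := fun q : EuclideanSpace ℝ (Fin n) × ℝ => (q.1, WithLp.toLp 2 fun _ : Fin 1 => q.2))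
    ⟨fun _ _ => rfl, fun _ _ => rfl⟩
  have h2 := definableSet_linear_pos (D := D) (X := EuclideanSpace ℝ (Fin n) × ℝ) (l := Prod.snd)
    ⟨fun _ _ => rfl, fun _ _ => rfl⟩ 0
  convert h2.inter h1 using 1
  ext q
  simp only [mem_ofPred_eq, mem_inter_iff, one_mul, EuclideanSpace.norm_sq_eq (𝕜 := ℝ) (n := Fin 1),
    Finset.univ_unique, Finset.sum_singleton, Real.norm_eq_abs, sq_abs]
  constructor
  · intro h
    have h0 : 0 < q.2 := (norm_nonneg _).trans_lt h
    exact ⟨h0, by gcongr⟩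
  · rintro ⟨h0, h⟩
    exact lt_of_pow_lt_pow_left₀ 2 h0.le h

end Atoms

end OMinimalStructure

/-! ### A definable radius of almost linearity -/

/-- `r` is uniformly close to linear on `B ⊆ U`: it is `3`-Lipschitz there, and its increments along
a vector `u` vary by at most `‖u‖ / 10` with the base point. This is a first-order substitute for
"`r` is `C¹` with derivative almost constant on `B`", stated without mentioning the derivative. -/
structure AlmostLinearOn {n : ℕ} (U : Set (EuclideanSpace ℝ (Fin n)))
    (r : EuclideanSpace ℝ (Fin n) → EuclideanSpace ℝ (Fin n))
    (B : Set (EuclideanSpace ℝ (Fin n))) : Prop where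
  subset : B ⊆ U
  lipschitz : ∀ x ∈ B, ∀ y ∈ B, ‖r x - r y‖ ≤ 3 * ‖x - y‖
  increment : ∀ x ∈ B, ∀ y ∈ B, ∀ x' ∈ B, ∀ y' ∈ B, x - y = x' - y' →
    ‖r x - r y - (r x' - r y')‖ ≤ 1 / 10 * ‖x - y‖

namespace AlmostLinearOn

variable {n : ℕ} {U B B' : Set (EuclideanSpace ℝ (Fin n))}
  {r : EuclideanSpace ℝ (Fin n) → EuclideanSpace ℝ (Fin n)}

theorem mono (h : AlmostLinearOn U r B) (hB : B' ⊆ B) : AlmostLinearOn U r B' where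
  subset := hB.trans h.subset
  lipschitz x hx y hy := h.lipschitz x (hB hx) y (hB hy)
  increment x hx y hy x' hx' y' hy' := h.increment x (hB hx) y (hB hy) x' (hB hx') y' (hB hy')

end AlmostLinearOn

namespace OMinimalStructure

variable {D : OMinimalStructure} {n : ℕ} {M U : Set (EuclideanSpace ℝ (Fin n))}
  {r : EuclideanSpace ℝ (Fin n) → EuclideanSpace ℝ (Fin n)}

local notation "E" => EuclideanSpace ℝ (Fin n)

theorem definableSet_mem_ball {X : Type*} [AddCommGroup X] [Module ℝ X] {a b : X → E}
    {t : X → ℝ} (ha : IsLinearMap ℝ a) (hb : IsLinearMap ℝ b) (ht : IsLinearMap ℝ t) :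
    D.DefinableSet {q : X | a q ∈ Metric.ball (b q) (t q)} := by
  convert (definableSet_norm_lt (D := D) (n := n)).preimage (f := fun q => (a q - b q, t q))
    ⟨fun x y => by simp [ha.1, hb.1, ht.1, add_sub_add_comm],
      fun c x => by simp [ha.2, hb.2, ht.2, smul_sub]⟩ using 1
  ext q
  simp [dist_eq_norm]

theorem definableSet_almostLinearOn_ball (hU : D.IsDefinable U) (hr : D.IsDefinableMapOn r U) :
    D.DefinableSet {q : E × ℝ | AlmostLinearOn U r (Metric.ball q.1 q.2)} := by
  have hΓ := hr.definableSet
  have h1 : D.DefinableSet {q : E × ℝ | ∀ x : E, x ∈ Metric.ball q.1 q.2 → x ∈ U} := by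
    refine DefinableSet.forall (DefinableSet.imp (definableSet_mem_ball ?_ ?_ ?_)
      (hU.definableSet.preimage ?_)) <;> exact ⟨fun _ _ => rfl, fun _ _ => rfl⟩
  have h2 : D.DefinableSet {q : E × ℝ | ∀ w : (E × E) × (E × E),
      ((w.1.1 ∈ U ∧ w.1.2 = r w.1.1) ∧ (w.2.1 ∈ U ∧ w.2.2 = r w.2.1)) →
      (w.1.1 ∈ Metric.ball q.1 q.2 ∧ w.2.1 ∈ Metric.ball q.1 q.2) →
      ‖w.1.2 - w.2.2‖ ≤ 3 * ‖w.1.1 - w.2.1‖} := by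
    refine DefinableSet.forall (DefinableSet.imp (DefinableSet.and
      (hΓ.preimage (f := fun q : (E × ℝ) × ((E × E) × (E × E)) => q.2.1) ?_)
      (hΓ.preimage (f := fun q : (E × ℝ) × ((E × E) × (E × E)) => q.2.2) ?_))
      (DefinableSet.imp (DefinableSet.and (definableSet_mem_ball ?_ ?_ ?_)
      (definableSet_mem_ball ?_ ?_ ?_))
      ((definableSet_norm_le (by norm_num)).preimage
        (f := fun q : (E × ℝ) × ((E × E) × (E × E)) =>
          (q.2.1.2 - q.2.2.2, q.2.1.1 - q.2.2.1)) ?_)))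
    all_goals first
      | exact ⟨fun _ _ => rfl, fun _ _ => rfl⟩
      | exact ⟨fun _ _ => by simp [add_sub_add_comm], fun _ _ => by simp [smul_sub]⟩
  -- a norm being at most `0 * ‖_‖` expresses the equality of the two increments
  have h3 : D.DefinableSet {q : E × ℝ | ∀ w : ((E × E) × (E × E)) × ((E × E) × (E × E)),
      (((w.1.1.1 ∈ U ∧ w.1.1.2 = r w.1.1.1) ∧ (w.1.2.1 ∈ U ∧ w.1.2.2 = r w.1.2.1)) ∧
       ((w.2.1.1 ∈ U ∧ w.2.1.2 = r w.2.1.1) ∧ (w.2.2.1 ∈ U ∧ w.2.2.2 = r w.2.2.1))) →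
      ((w.1.1.1 ∈ Metric.ball q.1 q.2 ∧ w.1.2.1 ∈ Metric.ball q.1 q.2) ∧
       (w.2.1.1 ∈ Metric.ball q.1 q.2 ∧ w.2.2.1 ∈ Metric.ball q.1 q.2)) →
      ‖w.1.1.1 - w.1.2.1 - (w.2.1.1 - w.2.2.1)‖ ≤ 0 * ‖w.1.1.1‖ →
      ‖w.1.1.2 - w.1.2.2 - (w.2.1.2 - w.2.2.2)‖ ≤ 1 / 10 * ‖w.1.1.1 - w.1.2.1‖} := by
    refine DefinableSet.forall (DefinableSet.imp (DefinableSet.and (DefinableSet.and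
      (hΓ.preimage (f := fun q : (E × ℝ) × (((E × E) × (E × E)) × ((E × E) × (E × E))) =>
        q.2.1.1) ?_)
      (hΓ.preimage (f := fun q : (E × ℝ) × (((E × E) × (E × E)) × ((E × E) × (E × E))) =>
        q.2.1.2) ?_)) (DefinableSet.and
      (hΓ.preimage (f := fun q : (E × ℝ) × (((E × E) × (E × E)) × ((E × E) × (E × E))) =>
        q.2.2.1) ?_)
      (hΓ.preimage (f := fun q : (E × ℝ) × (((E × E) × (E × E)) × ((E × E) × (E × E))) =>
        q.2.2.2) ?_)))
      (DefinableSet.imp (DefinableSet.and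
        (DefinableSet.and (definableSet_mem_ball ?_ ?_ ?_)
          (definableSet_mem_ball ?_ ?_ ?_))
        (DefinableSet.and (definableSet_mem_ball ?_ ?_ ?_)
          (definableSet_mem_ball ?_ ?_ ?_)))
      (DefinableSet.imp
      ((definableSet_norm_le le_rfl).preimage
        (f := fun q : (E × ℝ) × (((E × E) × (E × E)) × ((E × E) × (E × E))) =>
          (q.2.1.1.1 - q.2.1.2.1 - (q.2.2.1.1 - q.2.2.2.1), q.2.1.1.1)) ?_)
      ((definableSet_norm_le (by norm_num)).preimage
        (f := fun q : (E × ℝ) × (((E × E) × (E × E)) × ((E × E) × (E × E))) =>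
          (q.2.1.1.2 - q.2.1.2.2 - (q.2.2.1.2 - q.2.2.2.2), q.2.1.1.1 - q.2.1.2.1)) ?_))))
    all_goals first
      | exact ⟨fun _ _ => rfl, fun _ _ => rfl⟩
      | exact ⟨fun _ _ => by simp [add_sub_add_comm], fun _ _ => by simp [smul_sub]⟩
  convert (h1.inter h2).inter h3 using 1
  ext q
  simp only [mem_ofPred_eq, mem_inter_iff]
  constructor
  · intro h
    refine ⟨⟨fun x hx => h.subset hx, ?_⟩, ?_⟩
    · rintro ⟨⟨x, a⟩, ⟨y, b⟩⟩ ⟨⟨-, ha⟩, ⟨-, hb⟩⟩ ⟨hx, hy⟩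
      dsimp only at ha hb ⊢
      rw [ha, hb]
      exact h.lipschitz x hx y hy
    · rintro ⟨⟨⟨x, a⟩, ⟨y, b⟩⟩, ⟨⟨x', a'⟩, ⟨y', b'⟩⟩⟩ ⟨⟨⟨-, ha⟩, ⟨-, hb⟩⟩, ⟨⟨-, ha'⟩, ⟨-, hb'⟩⟩⟩
        ⟨⟨hx, hy⟩, ⟨hx', hy'⟩⟩ h0
      dsimp only at ha hb ha' hb' h0 ⊢
      rw [ha, hb, ha', hb']
      refine h.increment x hx y hy x' hx' y' hy' ?_
      rw [zero_mul, norm_le_zero_iff, sub_eq_zero] at h0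
      exact h0
  · rintro ⟨⟨hs, hl⟩, hi⟩
    refine ⟨hs, fun x hx y hy => ?_, fun x hx y hy x' hx' y' hy' h0 => ?_⟩
    · exact hl ((x, r x), (y, r y)) ⟨⟨hs x hx, rfl⟩, ⟨hs y hy, rfl⟩⟩ ⟨hx, hy⟩
    · refine hi (((x, r x), (y, r y)), ((x', r x'), (y', r y')))
        ⟨⟨⟨hs x hx, rfl⟩, ⟨hs y hy, rfl⟩⟩, ⟨⟨hs x' hx', rfl⟩, ⟨hs y' hy', rfl⟩⟩⟩
        ⟨⟨hx, hy⟩, ⟨hx', hy'⟩⟩ ?_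
      simp [h0]

/-- A local property of points of a closed set `M`, holding on balls and definable in centre and
radius, holds on balls of radius given by a positive, `1`-Lipschitz, definable function. No
cell decomposition is needed: the largest radius that works for all points of `M` within that same
radius of `x` is automatically `1`-Lipschitz in `x`, also off `M`. -/
theorem exists_definable_radius {G : Set E → Prop} (hmono : ∀ A B, G B → A ⊆ B → G A)
    (hG : D.DefinableSet {q : E × ℝ | G (Metric.ball q.1 q.2)})
    (hMdef : D.IsDefinable M) (hM : IsClosed M)
    (hloc : ∀ p ∈ M, ∃ t > 0, G (Metric.ball p t)) :
    ∃ δ : E → ℝ, (∀ x, 0 < δ x) ∧ (∀ x, δ x ≤ 1) ∧ (∀ x y, δ x ≤ δ y + ‖x - y‖) ∧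
      D.DefinableSet {q : E × ℝ | q.2 = δ q.1} ∧ ∀ p ∈ M, ∀ t < δ p, G (Metric.ball p t) := by
  -- a radius `t ≤ 0` is admitted, the balls being empty; this makes the set of radii nonempty
  let Q : E → ℝ → Prop := fun x t =>
    t ≤ 1 ∧ ∀ p : E, p ∈ M → x ∈ Metric.ball p t → G (Metric.ball p t)
  let δ : E → ℝ := fun x => sSup {t | Q x t}
  have hne : ∀ x, ({t | Q x t}).Nonempty := fun x => ⟨0, zero_le_one, by simp⟩
  have hbdd : ∀ x, BddAbove {t | Q x t} := fun x => ⟨1, fun t ht => ht.1⟩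
  have hlub : ∀ x, IsLUB {t | Q x t} (δ x) := fun x => isLUB_csSup (hne x) (hbdd x)
  have hshift : ∀ x y t, Q y t → Q x (t - ‖x - y‖) := by
    intro x y t ht
    refine ⟨by linarith [ht.1, norm_nonneg (x - y)], fun p hp hx => ?_⟩
    have hy : y ∈ Metric.ball p t := by
      rw [Metric.mem_ball] at hx ⊢
      have := dist_triangle y x p
      rw [dist_comm y x, dist_eq_norm x y] at this
      linarith
    exact hmono _ _ (ht.2 p hp hy) (Metric.ball_subset_ball (by linarith [norm_nonneg (x - y)]))
  have hpos : ∀ x, 0 < δ x := by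
    intro x
    have : ∃ t > 0, Q x t := by
      by_cases hx : x ∈ M
      · obtain ⟨t, ht, hGt⟩ := hloc x hx
        refine ⟨min (t / 2) 1, by positivity, min_le_right _ _, fun p hp hxp => ?_⟩
        refine hmono _ _ hGt fun y hy => ?_
        rw [Metric.mem_ball] at hy hxp ⊢
        have := dist_triangle y p x
        rw [dist_comm p x] at this
        linarith [min_le_left (t / 2) 1]
      · obtain ⟨t, ht, hb⟩ := Metric.isOpen_iff.1 hM.isOpen_compl x hx
        refine ⟨min t 1, by positivity, min_le_right _ _, fun p hp hxp => ?_⟩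
        refine absurd hp (hb ?_)
        rw [Metric.mem_ball, dist_comm]
        exact (Metric.mem_ball.1 hxp).trans_le (min_le_left _ _)
    obtain ⟨t, ht, hQ⟩ := this
    exact ht.trans_le ((hlub x).1 hQ)
  have hQdef : D.DefinableSet {q : E × ℝ | Q q.1 q.2} := by
    refine DefinableSet.and (P := fun q : E × ℝ => q.2 ≤ 1) ?_
      (DefinableSet.forall (DefinableSet.imp (hMdef.definableSet.preimage ?_)
        (DefinableSet.imp (definableSet_mem_ball ?_ ?_ ?_)
          (hG.preimage (f := fun q : (E × ℝ) × E => (q.2, q.1.2)) ?_))))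
    · convert (definableSet_linear_pos (D := D) (X := E × ℝ) (l := Prod.snd)
        ⟨fun _ _ => rfl, fun _ _ => rfl⟩ 1).compl using 1
      ext q; simp
    all_goals exact ⟨fun _ _ => rfl, fun _ _ => rfl⟩
  have hle : D.DefinableSet {q : ℝ × ℝ | q.1 ≤ q.2} := by
    convert (definableSet_linear_pos (D := D) (X := ℝ × ℝ) (l := fun q => q.1 - q.2)
      ⟨fun _ _ => by simp [add_sub_add_comm], fun _ _ => by simp [mul_sub]⟩ 0).compl using 1
    ext q; simp
  have hub : D.DefinableSet {q : E × ℝ | ∀ t : ℝ, Q q.1 t → t ≤ q.2} := by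
    refine DefinableSet.forall (DefinableSet.imp
      (hQdef.preimage (f := fun q : (E × ℝ) × ℝ => (q.1.1, q.2)) ?_)
      (hle.preimage (f := fun q : (E × ℝ) × ℝ => (q.2, q.1.2)) ?_))
    all_goals exact ⟨fun _ _ => rfl, fun _ _ => rfl⟩
  refine ⟨δ, hpos, fun x => (hlub x).2 fun t ht => ht.1, ?_, ?_, ?_⟩
  · intro x y
    refine (hlub x).2 fun t ht => ?_
    have := (hlub y).1 (hshift y x t ht)
    rw [norm_sub_rev] at this
    linarith
  · have h2 : D.DefinableSet {q : E × ℝ | ∀ b : ℝ, (∀ t : ℝ, Q q.1 t → t ≤ b) → q.2 ≤ b} := by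
      refine DefinableSet.forall (DefinableSet.imp
        (hub.preimage (f := fun q : (E × ℝ) × ℝ => (q.1.1, q.2)) ?_)
        (hle.preimage (f := fun q : (E × ℝ) × ℝ => (q.1.2, q.2)) ?_))
      all_goals exact ⟨fun _ _ => rfl, fun _ _ => rfl⟩
    convert hub.inter h2 using 1
    ext q
    simp only [mem_ofPred_eq, mem_inter_iff]
    constructor
    · intro hq
      rw [hq]
      exact ⟨fun t ht => (hlub q.1).1 ht, fun b hb => (hlub q.1).2 hb⟩
    · rintro ⟨h1, h3⟩
      exact IsLUB.unique ⟨fun t ht => h1 t ht, fun b hb => h3 b hb⟩ (hlub q.1)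
  · intro p hp t ht
    obtain ⟨s, hs, hts⟩ := exists_lt_of_lt_csSup (hne p) ht
    by_cases h0 : 0 < s
    · exact hmono _ _ (hs.2 p hp (Metric.mem_ball_self h0)) (Metric.ball_subset_ball hts.le)
    · obtain ⟨s', -, hG'⟩ := hloc p hp
      refine hmono _ _ hG' ?_
      rw [Metric.ball_eq_empty.2 (by linarith)]
      exact empty_subset _

end OMinimalStructure

/-! ### Local parametrizations and the inverse function theorem -/

/-- Germs of a local parametrization `φ` of `M` at `x`, with `m` parameters, and of a left inverse
`π` of it defined on the ambient space. The base parameter is `π x`. -/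
structure IsLocalParam {n m : ℕ} (p : WithTop ℕ∞) (M : Set (EuclideanSpace ℝ (Fin n)))
    (x : EuclideanSpace ℝ (Fin n)) (φ : EuclideanSpace ℝ (Fin m) → EuclideanSpace ℝ (Fin n))
    (π : EuclideanSpace ℝ (Fin n) → EuclideanSpace ℝ (Fin m)) : Prop where
  contDiffAt : ContDiffAt ℝ p φ (π x)
  contDiffAt_left : ContDiffAt ℝ p π x
  apply_self : φ (π x) = x
  eventually_mem : ∀ᶠ v in 𝓝 (π x), φ v ∈ M
  eventually_left : ∀ᶠ v in 𝓝 (π x), π (φ v) = v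
  eventually_right : ∀ᶠ y in 𝓝 x, y ∈ M → φ (π y) = y

theorem IsSubmanifold.exists_isLocalParam {n : ℕ} {p : WithTop ℕ∞}
    {M : Set (EuclideanSpace ℝ (Fin n))} (hM : IsSubmanifold p M) :
    ∃ m : ℕ, ∀ x ∈ M, ∃ (φ : EuclideanSpace ℝ (Fin m) → EuclideanSpace ℝ (Fin n))
      (π : EuclideanSpace ℝ (Fin n) → EuclideanSpace ℝ (Fin m)), IsLocalParam p M x φ π := by
  obtain ⟨m, hmn, hM⟩ := hM
  refine ⟨m, fun x hx => ?_⟩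
  obtain ⟨Φ, hxs, hΦ, hΦs, hiff⟩ := hM x hx
  let ι : EuclideanSpace ℝ (Fin m) → EuclideanSpace ℝ (Fin n) := fun v =>
    WithLp.toLp 2 fun i => if h : (i : ℕ) < m then v ⟨i, h⟩ else 0
  let pr : EuclideanSpace ℝ (Fin n) → EuclideanSpace ℝ (Fin m) := fun y =>
    WithLp.toLp 2 fun j => y (Fin.castLE hmn j)
  have hι : ContDiff ℝ p ι := by
    rw [contDiff_euclidean]
    intro i
    by_cases h : (i : ℕ) < m
    · simp only [ι, h, dite_true]; fun_prop
    · simp only [ι, h, dite_false]; fun_prop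
  have hpr : ContDiff ℝ p pr := by
    rw [contDiff_euclidean]
    intro i
    simp only [pr]; fun_prop
  have hprι : ∀ v, pr (ι v) = v := by
    intro v; ext j; simp [pr, ι]
  have hιpr : ∀ y, (∀ i : Fin n, m ≤ (i : ℕ) → y i = 0) → ι (pr y) = y := by
    intro y hy; ext i
    by_cases h : (i : ℕ) < m
    · simp [pr, ι, h]
    · simp [ι, h, hy i (not_lt.1 h)]
  have hx0 : ι (pr (Φ x)) = Φ x := hιpr _ ((hiff x hxs).1 hx)
  have htgt : ∀ᶠ v in 𝓝 (pr (Φ x)), ι v ∈ Φ.target := by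
    refine hι.continuous.continuousAt.eventually_mem ?_
    rw [hx0]
    exact Φ.open_target.mem_nhds (Φ.map_source hxs)
  refine ⟨Φ.symm ∘ ι, pr ∘ Φ, ?_, ?_, ?_, ?_, ?_, ?_⟩
  · refine ContDiffAt.comp _ ?_ hι.contDiffAt
    simp only [Function.comp_apply, hx0]
    exact hΦs.contDiffAt (Φ.open_target.mem_nhds (Φ.map_source hxs))
  · exact hpr.contDiffAt.comp _ (hΦ.contDiffAt (Φ.open_source.mem_nhds hxs))
  · simp [hx0, Φ.left_inv hxs]
  · filter_upwards [htgt] with v hv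
    refine (hiff _ (Φ.map_target hv)).2 fun i hi => ?_
    simp only [Φ.right_inv hv]
    simp [ι, not_lt.2 hi]
  · filter_upwards [htgt] with v hv
    simp [Φ.right_inv hv, hprι]
  · filter_upwards [Φ.open_source.mem_nhds hxs] with y hy hyM
    simp only [Function.comp_apply, hιpr _ ((hiff y hy).1 hyM), Φ.left_inv hy]

/-- A `C¹` map is Lipschitz near a point, with positive constant. -/
theorem ContDiffAt.exists_norm_sub_le {X Y : Type*} [NormedAddCommGroup X] [NormedSpace ℝ X]
    [NormedAddCommGroup Y] [NormedSpace ℝ Y] {f : X → Y} {a : X} (hf : ContDiffAt ℝ 1 f a) :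
    ∃ C > 0, ∃ s ∈ 𝓝 a, ∀ x ∈ s, ∀ y ∈ s, ‖f x - f y‖ ≤ C * ‖x - y‖ := by
  obtain ⟨K, s, hs, hK⟩ := hf.exists_lipschitzOnWith
  refine ⟨K + 1, by positivity, s, hs, fun x hx y hy => ?_⟩
  have := hK.norm_sub_le hx hy
  nlinarith [norm_nonneg (x - y)]

theorem HasFDerivAt.injective_of_le_norm_sub {X Y : Type*} [NormedAddCommGroup X]
    [NormedSpace ℝ X] [NormedAddCommGroup Y] [NormedSpace ℝ Y] {f : X → Y} {f' : X →L[ℝ] Y}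
    {a : X} (hf : HasFDerivAt f f' a) {c : ℝ} (hc : 0 < c)
    (h : ∀ᶠ x in 𝓝 a, c * ‖x - a‖ ≤ ‖f x - f a‖) : Function.Injective f' := by
  rw [injective_iff_map_eq_zero]
  intro w hw
  have h1 := hf.isLittleO.def (half_pos hc)
  have ht : Filter.Tendsto (fun t : ℝ => a + t • w) (𝓝[≠] 0) (𝓝 a) := by
    have : Continuous fun t : ℝ => a + t • w := by fun_prop
    simpa using (this.tendsto 0).mono_left nhdsWithin_le_nhds
  obtain ⟨t, ⟨h2, h3⟩, ht0⟩ :=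
    ((ht.eventually (h1.and h)).and (eventually_mem_nhdsWithin (a := (0 : ℝ)) (s := {0}ᶜ))).exists
  simp only [add_sub_cancel_left, map_smul, hw, smul_zero, sub_zero] at h2 h3
  have h4 : ‖t • w‖ ≤ 0 := by nlinarith [norm_nonneg (t • w)]
  rw [norm_le_zero_iff, smul_eq_zero] at h4
  exact h4.resolve_left ht0

/-- The inverse function theorem in equal finite dimensions, for an injective derivative. -/
theorem ContDiffAt.exists_local_inverse {X Y : Type*} [NormedAddCommGroup X] [NormedSpace ℝ X]
    [NormedAddCommGroup Y] [NormedSpace ℝ Y] [FiniteDimensional ℝ X] [FiniteDimensional ℝ Y]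
    {f : X → Y} {a : X} {q : WithTop ℕ∞} (hq : q ≠ 0) (hf : ContDiffAt ℝ q f a)
    (hdim : Module.finrank ℝ X = Module.finrank ℝ Y)
    (hinj : Function.Injective (fderiv ℝ f a)) :
    ∃ g : Y → X, ContDiffAt ℝ q g (f a) ∧ g (f a) = a ∧ (∀ᶠ x in 𝓝 a, g (f x) = x) ∧
      ∀ᶠ y in 𝓝 (f a), f (g y) = y := by
  let e : X ≃L[ℝ] Y :=
    (LinearEquiv.ofInjectiveOfFinrankEq (fderiv ℝ f a).toLinearMap hinj
      hdim).toContinuousLinearEquiv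
  have he : HasFDerivAt f (e : X →L[ℝ] Y) a := by
    convert (hf.differentiableAt hq).hasFDerivAt using 1
    ext x; rfl
  have : CompleteSpace X := FiniteDimensional.complete ℝ X
  exact ⟨hf.localInverse he hq, hf.to_localInverse he hq, hf.localInverse_apply_image he hq,
    (hf.hasStrictFDerivAt' he hq).eventually_left_inverse,
    (hf.hasStrictFDerivAt' he hq).eventually_right_inverse⟩

/-- A function growing at least quadratically away from `0` does not have a degenerate second
derivative there. -/
theorem not_hasDerivAt_zero_of_quadratic_growth {u ρ : ℝ → ℝ} {c : ℝ} (hc : 0 < c)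
    (hu : ∀ᶠ t in 𝓝 0, HasDerivAt u (ρ t) t) (hgrowth : ∀ᶠ t in 𝓝 0, c * t ^ 2 ≤ u t - u 0) :
    ¬ HasDerivAt ρ 0 0 := by
  intro hρ
  have hmin : IsLocalMin u 0 := by
    filter_upwards [hgrowth] with t ht
    nlinarith [sq_nonneg t]
  have hρ0 : ρ 0 = 0 := hmin.hasDerivAt_eq_zero hu.self_of_nhds
  have hsmall := (hasDerivAt_iff_isLittleO.1 hρ).def (half_pos hc)
  obtain ⟨η, hη, hball⟩ := Metric.eventually_nhds_iff.1 (hu.and (hgrowth.and hsmall))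
  have hmem : ∀ t ∈ Icc 0 (η / 2), dist t 0 < η := fun t ht => by
    rw [Real.dist_eq, sub_zero, abs_of_nonneg ht.1]; linarith [ht.2]
  obtain ⟨ξ, hξ, hslope⟩ := exists_hasDerivAt_eq_slope u ρ (half_pos hη)
    (fun t ht => (hball (hmem t ht)).1.continuousAt.continuousWithinAt)
    (fun t ht => (hball (hmem t ⟨ht.1.le, ht.2.le⟩)).1)
  have h1 := (hball (hmem (η / 2) ⟨by positivity, le_rfl⟩)).2.1
  have h2 := (hball (hmem ξ ⟨hξ.1.le, hξ.2.le⟩)).2.2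
  simp only [hρ0, sub_zero, smul_zero, Real.norm_eq_abs, abs_of_pos hξ.1] at h2
  have h3 : u (η / 2) - u 0 = ρ ξ * (η / 2) := by
    rw [hslope, sub_zero, div_mul_cancel₀ _ (half_pos hη).ne']
  have h4 : ρ ξ ≤ c / 2 * ξ := (le_abs_self _).trans h2
  have h5 : ρ ξ < c * (η / 2) := by nlinarith [hξ.1, hξ.2]
  nlinarith [mul_lt_mul_of_pos_right h5 (half_pos hη)]

/-! ### Smoothness of nearest point maps -/

section NearestPoint

variable {n : ℕ}
local notation "E" => EuclideanSpace ℝ (Fin n)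

open scoped RealInnerProductSpace

/-- The critical point equation of the distance to a parametrized set, made into a map between
spaces of equal dimension: `(v, x) ↦ ((⟪x - φ v, ∂ᵢ φ v⟫)ᵢ, x)`. The foot points of `x` have
parameters `v` that are mapped to `(0, x)`. -/
noncomputable def criticalMap {m : ℕ} (φ : EuclideanSpace ℝ (Fin m) → E)
    (a : EuclideanSpace ℝ (Fin m) × E) : EuclideanSpace ℝ (Fin m) × E :=
  (WithLp.toLp 2 fun i => ⟪a.2 - φ a.1, fderiv ℝ φ a.1 (EuclideanSpace.single i 1)⟫, a.2)

theorem contDiffAt_criticalMap {m : ℕ} {p q : WithTop ℕ∞} (hpq : q + 1 ≤ p)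
    {φ : EuclideanSpace ℝ (Fin m) → E} {a : EuclideanSpace ℝ (Fin m) × E}
    (hφ : ContDiffAt ℝ p φ a.1) : ContDiffAt ℝ q (criticalMap φ) a := by
  refine ContDiffAt.prodMk ?_ contDiffAt_snd
  rw [contDiffAt_euclidean]
  intro i
  have h1 : ContDiffAt ℝ q φ a.1 := hφ.of_le (le_self_add.trans hpq)
  have h2 : ContDiffAt ℝ q (fderiv ℝ φ) a.1 := hφ.fderiv_right hpq
  exact (contDiffAt_snd.sub (h1.comp a contDiffAt_fst)).inner ℝ
    ((h2.comp a contDiffAt_fst).clm_apply contDiffAt_const)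

theorem inner_fderiv_eq_sum {m : ℕ} (φ : EuclideanSpace ℝ (Fin m) → E)
    (a : EuclideanSpace ℝ (Fin m) × E) (w : EuclideanSpace ℝ (Fin m)) :
    ⟪a.2 - φ a.1, fderiv ℝ φ a.1 w⟫ = ∑ i, w i * (criticalMap φ a).1 i := by
  conv_lhs => rw [← (EuclideanSpace.basisFun (Fin m) ℝ).sum_repr w]
  simp [map_sum, inner_sum, inner_smul_right, criticalMap]

theorem hasDerivAt_half_normSq_sub {m : ℕ} {φ : EuclideanSpace ℝ (Fin m) → E} (x : E)
    (v w : EuclideanSpace ℝ (Fin m)) (t : ℝ) (hφ : DifferentiableAt ℝ φ (v + t • w)) :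
    HasDerivAt (fun t : ℝ => ‖x - φ (v + t • w)‖ ^ 2 / 2)
      (-⟪x - φ (v + t • w), fderiv ℝ φ (v + t • w) w⟫) t := by
  have h1 : HasDerivAt (fun t : ℝ => v + t • w) w t := by
    simpa using ((hasDerivAt_id t).smul_const w).const_add v
  have h2 : HasDerivAt (fun t : ℝ => x - φ (v + t • w)) (-(fderiv ℝ φ (v + t • w) w)) t :=
    (hφ.hasFDerivAt.comp_hasDerivAt t h1).const_sub x
  exact ((h2.norm_sq).div_const 2).congr_deriv (by rw [inner_neg_right]; ring)

/-- If the squared distance to `x` grows quadratically along `M` away from `y = φ (π y)`, then the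
Hessian of this squared distance is nondegenerate, that is, the derivative of the critical map is injective. -/
theorem injective_fderiv_criticalMap {m : ℕ} {p : WithTop ℕ∞} (hp : 2 ≤ p) {M : Set E} {y x : E}
    {φ : EuclideanSpace ℝ (Fin m) → E} {π : E → EuclideanSpace ℝ (Fin m)}
    (hφ : IsLocalParam p M y φ π) {c : ℝ} (hc : 0 < c)
    (hgrowth : ∀ᶠ z in 𝓝 y, z ∈ M → c * ‖z - y‖ ^ 2 ≤ ‖x - z‖ ^ 2 - ‖x - y‖ ^ 2) :
    Function.Injective (fderiv ℝ (criticalMap φ) (π y, x)) := by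
  have hp1 : (1 : WithTop ℕ∞) ≤ p := le_trans (by norm_num) hp
  rw [injective_iff_map_eq_zero]
  rintro ⟨w, ξ⟩ hw
  have hG : HasFDerivAt (criticalMap φ) (fderiv ℝ (criticalMap φ) (π y, x)) (π y, x) :=
    ((contDiffAt_criticalMap (q := 1) (by norm_num; exact hp) hφ.contDiffAt).differentiableAt
      one_ne_zero).hasFDerivAt
  -- the second component of the critical map is `x`
  have hξ : ξ = 0 := by
    have h1 : HasFDerivAt (fun a => (criticalMap φ a).2) _ (π y, x) := hG.snd
    have h2 : HasFDerivAt (fun a : EuclideanSpace ℝ (Fin m) × E => (criticalMap φ a).2)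
        (ContinuousLinearMap.snd ℝ _ _) (π y, x) := hasFDerivAt_snd
    have h3 := congrArg (fun l => l (w, ξ)) (h1.unique h2)
    simpa [hw] using h3.symm
  subst hξ
  by_contra hne
  have hw0 : w ≠ 0 := fun h => hne (by simp [h])
  -- along the line `t ↦ π y + t w` the derivative of the squared distance is stationary at `0`
  have hline : HasDerivAt (fun t : ℝ => (π y + t • w, x)) (w, (0 : E)) 0 := by
    have : HasDerivAt (fun t : ℝ => π y + t • w) w 0 := by
      simpa using ((hasDerivAt_id (0 : ℝ)).smul_const w).const_add (π y)
    exact this.prodMk (hasDerivAt_const _ _)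
  have hGl : HasDerivAt (fun t : ℝ => criticalMap φ (π y + t • w, x)) 0 0 := by
    have := HasFDerivAt.comp_hasDerivAt (f := fun t : ℝ => (π y + t • w, x)) (0 : ℝ)
      (l := criticalMap φ) (l' := fderiv ℝ (criticalMap φ) (π y, x)) (by simpa using hG) hline
    rwa [hw] at this
  have hρ : HasDerivAt
      (fun t : ℝ => -⟪x - φ (π y + t • w), fderiv ℝ φ (π y + t • w) w⟫) 0 0 := by
    have h1 : ∀ i, HasDerivAt (fun t : ℝ => (criticalMap φ (π y + t • w, x)).1 i) 0 0 := by
      intro i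
      have h0 : HasDerivAt (fun t : ℝ => (criticalMap φ (π y + t • w, x)).1) 0 0 :=
        (HasFDerivAt.comp_hasDerivAt (0 : ℝ) (l := Prod.fst)
          (l' := ContinuousLinearMap.fst ℝ _ _) hasFDerivAt_fst hGl).congr_deriv (map_zero _)
      exact (EuclideanSpace.proj (𝕜 := ℝ) i).hasFDerivAt.comp_hasDerivAt (0 : ℝ) h0
    have h2 := (HasDerivAt.fun_sum fun i (_ : i ∈ Finset.univ) => (h1 i).const_mul (w i)).neg
    simp only [mul_zero, Finset.sum_const_zero, neg_zero] at h2
    refine h2.congr_of_eventuallyEq (Filter.Eventually.of_forall fun t => ?_)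
    simp only [Pi.neg_apply]
    rw [inner_fderiv_eq_sum φ (π y + t • w, x) w]
  have hcont : Filter.Tendsto (fun t : ℝ => π y + t • w) (𝓝 0) (𝓝 (π y)) := by
    have : Continuous fun t : ℝ => π y + t • w := by fun_prop
    simpa using this.tendsto 0
  have hcy : Filter.Tendsto φ (𝓝 (π y)) (𝓝 y) := by
    have := hφ.contDiffAt.continuousAt.tendsto
    rwa [hφ.apply_self] at this
  obtain ⟨C, hC, s, hs, hlip⟩ := (hφ.contDiffAt_left.of_le hp1).exists_norm_sub_le
  refine not_hasDerivAt_zero_of_quadratic_growth (c := c * (‖w‖ / C) ^ 2 / 2)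
    (u := fun t : ℝ => ‖x - φ (π y + t • w)‖ ^ 2 / 2) ?_ ?_ ?_ hρ
  · have := norm_pos_iff.2 hw0
    positivity
  · have hd := ((hφ.contDiffAt.of_le hp1).eventually (by decide)).mono
      fun v hv => hv.differentiableAt one_ne_zero
    filter_upwards [hcont.eventually hd] with t ht
    exact hasDerivAt_half_normSq_sub x _ w t ht
  · filter_upwards [hcont.eventually hφ.eventually_mem, hcont.eventually hφ.eventually_left,
      (hcy.comp hcont).eventually hgrowth, (hcy.comp hcont).eventually hs] with t h1 h2 h3 h4
    have h5 := h3 h1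
    have h6 := hlip _ h4 y (mem_of_mem_nhds hs)
    simp only [Function.comp_apply, h2, add_sub_cancel_left, norm_smul, Real.norm_eq_abs] at h5 h6
    simp only [zero_smul, add_zero, hφ.apply_self]
    have h7 : |t| * (‖w‖ / C) ≤ ‖φ (π y + t • w) - y‖ := by
      rw [← mul_div_assoc, div_le_iff₀ hC]; linarith
    have h8 : t ^ 2 * (‖w‖ / C) ^ 2 ≤ ‖φ (π y + t • w) - y‖ ^ 2 := by
      rw [← sq_abs t, ← mul_pow]; gcongr
    nlinarith

/-- Nearest point maps are of class `C^q` where the squared distance to a `C^{q+1}` submanifold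
grows quadratically away from the foot point: by the inverse function theorem the critical point
equation has smooth solutions there, and continuity singles out the one given by `r`. -/
theorem contDiffAt_nearestPoint {p q : WithTop ℕ∞} (hq : q ≠ 0) (hpq : q + 1 ≤ p)
    {M U : Set E} {r : E → E} {x : E} (hM : IsSubmanifold p M) (hU : U ∈ 𝓝 x)
    (hr : ContinuousAt r x) (hmaps : MapsTo r U M)
    (hnear : ∀ z ∈ U, ∀ y ∈ M, ‖z - r z‖ ≤ ‖z - y‖) {c : ℝ} (hc : 0 < c)
    (hgrowth : ∀ᶠ z in 𝓝 (r x), z ∈ M → c * ‖z - r x‖ ^ 2 ≤ ‖x - z‖ ^ 2 - ‖x - r x‖ ^ 2) :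
    ContDiffAt ℝ q r x := by
  have hq1 : (1 : WithTop ℕ∞) ≤ q := ENat.one_le_iff_ne_zero_withTop.mpr hq
  have hp2 : (2 : WithTop ℕ∞) ≤ p := by
    refine le_trans ?_ hpq
    calc (2 : WithTop ℕ∞) = 1 + 1 := by norm_num
      _ ≤ q + 1 := by gcongr
  have hp1 : (1 : WithTop ℕ∞) ≤ p := le_trans (by norm_num) hp2
  obtain ⟨m, hM⟩ := hM.exists_isLocalParam
  obtain ⟨φ, π, hφ⟩ := hM _ (hmaps (mem_of_mem_nhds hU))
  obtain ⟨g, hg, hg0, hleft, -⟩ := (contDiffAt_criticalMap (a := (π (r x), x)) hpq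
    hφ.contDiffAt).exists_local_inverse hq rfl (injective_fderiv_criticalMap hp2 hφ hc hgrowth)
  have hv : Filter.Tendsto (fun z => π (r z)) (𝓝 x) (𝓝 (π (r x))) :=
    hφ.contDiffAt_left.continuousAt.tendsto.comp hr
  have hd := ((hφ.contDiffAt.of_le hp1).eventually (by decide)).mono
      fun v hv => hv.differentiableAt one_ne_zero
  -- the parameter of the foot point solves the critical point equation
  have hcrit : ∀ᶠ z in 𝓝 x, criticalMap φ (π (r z), z) = (0, z) := by
    filter_upwards [hU, hv.eventually hφ.eventually_mem.eventually_nhds, hv.eventually hd,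
      hr.eventually hφ.eventually_right] with z hz hmem hdz hright
    have hrz : φ (π (r z)) = r z := hright (hmaps hz)
    refine Prod.ext ?_ rfl
    ext i
    have hline : Filter.Tendsto (fun t : ℝ => π (r z) + t • EuclideanSpace.single i (1 : ℝ)) (𝓝 0)
        (𝓝 (π (r z))) := by
      have : Continuous fun t : ℝ => π (r z) + t • EuclideanSpace.single i (1 : ℝ) := by fun_prop
      simpa using this.tendsto 0
    have hder := hasDerivAt_half_normSq_sub (φ := φ) z (π (r z)) (EuclideanSpace.single i 1) 0
      (by simpa using hdz)
    have hmin : IsLocalMin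
        (fun t : ℝ => ‖z - φ (π (r z) + t • EuclideanSpace.single i (1 : ℝ))‖ ^ 2 / 2) 0 := by
      filter_upwards [hline.eventually hmem] with t ht
      simp only [zero_smul, add_zero, hrz]
      have := hnear z hz _ ht
      gcongr
    have h0 := hmin.hasDerivAt_eq_zero hder
    simpa [criticalMap] using h0
  have hG0 : criticalMap φ (π (r x), x) = (0, x) := hcrit.self_of_nhds
  rw [hG0] at hg hg0
  have hpair : Filter.Tendsto (fun z => (π (r z), z)) (𝓝 x) (𝓝 (π (r x), x)) :=
    hv.prodMk_nhds Filter.tendsto_id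
  have heq : r =ᶠ[𝓝 x] fun z => φ (g (0, z)).1 := by
    filter_upwards [hpair.eventually hleft, hcrit, hU, hr.eventually hφ.eventually_right]
      with z h1 h2 hz h3
    rw [h2] at h1
    rw [h1, h3 (hmaps hz)]
  refine ContDiffAt.congr_of_eventuallyEq ?_ heq
  refine ContDiffAt.comp x (g := φ) ?_ (contDiffAt_fst.comp x (hg.comp x (by fun_prop)))
  simp only [hg0]
  exact hφ.contDiffAt.of_le (le_self_add.trans hpq)

/-- Where a nearest point map `r` is Lipschitz, the squared distance to `M` grows quadratically away
from the foot point. For a point `y` of `M`, the nearest point property is tested at the point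
`x + (y - r x) / 6`, a small displacement of `x` towards `y`. -/
theorem quadratic_growth_of_lipschitz {M B : Set E} {r : E → E} {x : E} (hB : B ∈ 𝓝 x)
    (hmaps : MapsTo r B M) (hnear : ∀ z ∈ B, ∀ y ∈ M, ‖z - r z‖ ≤ ‖z - y‖)
    (hlip : ∀ z ∈ B, ∀ z' ∈ B, ‖r z - r z'‖ ≤ 3 * ‖z - z'‖) :
    ∀ᶠ y in 𝓝 (r x), y ∈ M → 1 / 6 * ‖y - r x‖ ^ 2 ≤ ‖x - y‖ ^ 2 - ‖x - r x‖ ^ 2 := by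
  have ht : Filter.Tendsto (fun y => x + (1 / 6 : ℝ) • (y - r x)) (𝓝 (r x)) (𝓝 x) := by
    have : Continuous fun y => x + (1 / 6 : ℝ) • (y - r x) := by fun_prop
    simpa using this.tendsto (r x)
  have hxB := mem_of_mem_nhds hB
  filter_upwards [ht.eventually hB] with y hz hy
  set z := x + (1 / 6 : ℝ) • (y - r x) with hz_def
  have h1 := hnear z hz y hy
  have h2 := hnear x hxB (r z) (hmaps hz)
  have h3 := hlip z hz x hxB
  have hzx : z - x = (1 / 6 : ℝ) • (y - r x) := by simp [hz_def]
  have h1' : ‖z - r z‖ ^ 2 ≤ ‖z - y‖ ^ 2 := by gcongr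
  have h2' : ‖x - r x‖ ^ 2 ≤ ‖x - r z‖ ^ 2 := by gcongr
  have h4 : ⟪z - x, r z - r x⟫ ≤ 1 / 12 * ‖y - r x‖ ^ 2 := by
    refine (real_inner_le_norm _ _).trans ?_
    have : ‖z - x‖ = 1 / 6 * ‖y - r x‖ := by
      rw [hzx, norm_smul]; norm_num
    rw [this] at h3 ⊢
    nlinarith [norm_nonneg (y - r x)]
  have e1 : ‖z - r z‖ ^ 2 = ‖x - r z‖ ^ 2 + 2 * ⟪z - x, x - r z⟫ + ‖z - x‖ ^ 2 := by
    rw [show z - r z = (x - r z) + (z - x) by abel, norm_add_sq_real, real_inner_comm]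
  have e2 : ‖z - y‖ ^ 2 = ‖x - y‖ ^ 2 + 2 * ⟪z - x, x - y⟫ + ‖z - x‖ ^ 2 := by
    rw [show z - y = (x - y) + (z - x) by abel, norm_add_sq_real, real_inner_comm]
  have e3 : ⟪z - x, x - r z⟫ - ⟪z - x, x - y⟫ = ⟪z - x, y - r x⟫ - ⟪z - x, r z - r x⟫ := by
    simp only [inner_sub_right]; ring
  have e4 : ⟪z - x, y - r x⟫ = 1 / 6 * ‖y - r x‖ ^ 2 := by
    rw [hzx, real_inner_smul_left, real_inner_self_eq_norm_sq]
  nlinarith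

end NearestPoint

/-! ### Maps close to the identity of a closed set -/

section CloseInverse

variable {n : ℕ} {M N U : Set (EuclideanSpace ℝ (Fin n))}
  {r h k : EuclideanSpace ℝ (Fin n) → EuclideanSpace ℝ (Fin n)}
local notation "E" => EuclideanSpace ℝ (Fin n)

theorem HasDerivAt.mem_tangentConeAt {f : ℝ → E} {f' : E} {s : ℝ} (hf : HasDerivAt f f' s)
    (hN : ∀ᶠ τ in 𝓝 s, f τ ∈ N) : f' ∈ tangentConeAt ℝ N (f s) := by
  have h1 := (hf.hasFDerivAt.hasFDerivWithinAt (s := {τ | f τ ∈ N})).mapsTo_tangent_cone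
  rw [tangentConeAt_of_mem_nhds hN] at h1
  have h2 := h1 (mem_univ (1 : ℝ))
  simp only [ContinuousLinearMap.toSpanSingleton_apply, one_smul] at h2
  exact tangentConeAt_mono (by rintro _ ⟨τ, hτ, rfl⟩; exact hτ) h2

/-- If `h - id` has small derivative along `N`, then its inverse `k` moves tangent vectors of `M`
little. Tangent vectors are represented by curves in `M`, so that no description of the tangent
spaces is needed. -/
theorem exists_hasDerivAt_comp_inverse (hh : DifferentiableOn ℝ h N) (hk : DifferentiableOn ℝ k M)
    (hkN : MapsTo k M N) (hhk : ∀ y ∈ M, h (k y) = y)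
    (hd : ∀ x ∈ N, ‖derivOn (fun y => h y - y) N x‖ ≤ 1 / 100)
    {γ : ℝ → E} {γ' : E} {s : ℝ} (hγ : HasDerivAt γ γ' s) (hγM : ∀ᶠ τ in 𝓝 s, γ τ ∈ M) :
    ∃ b, HasDerivAt (fun τ => k (γ τ)) b s ∧ ‖b - γ'‖ ≤ 1 / 99 * ‖γ'‖ := by
  have hs : γ s ∈ M := hγM.self_of_nhds
  have h1 := (hk _ hs).hasFDerivWithinAt.comp_hasDerivAt s hγ hγM
  set b := fderivWithin ℝ k M (γ s) γ'
  have hb : HasDerivAt (fun τ => k (γ τ)) b s := h1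
  have hkγN : ∀ᶠ τ in 𝓝 s, k (γ τ) ∈ N := hγM.mono fun τ hτ => hkN hτ
  have hbT : b ∈ tangentSpaceAt N (k (γ s)) := Submodule.subset_span (hb.mem_tangentConeAt hkγN)
  have hdiff : DifferentiableWithinAt ℝ (fun y => h y - y) N (k (γ s)) :=
    (hh _ (hkN hs)).sub differentiableWithinAt_id
  have h2 := hdiff.hasFDerivWithinAt.comp_hasDerivAt s hb hkγN
  have h3 : HasDerivAt (fun τ => γ τ - k (γ τ)) (γ' - b) s := hγ.sub hb
  have h4 : fderivWithin ℝ (fun y => h y - y) N (k (γ s)) b = γ' - b := by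
    refine h2.unique (h3.congr_of_eventuallyEq ?_)
    filter_upwards [hγM] with τ hτ
    simp [hhk _ hτ]
  have h5 : ‖γ' - b‖ ≤ 1 / 100 * ‖b‖ := by
    rw [← h4]
    refine ((derivOn (fun y => h y - y) N (k (γ s))).le_opNorm ⟨b, hbT⟩).trans ?_
    exact mul_le_mul_of_nonneg_right (hd _ (hkN hs)) (norm_nonneg _)
  refine ⟨b, hb, ?_⟩
  have h6 := norm_le_norm_add_norm_sub' b γ'
  rw [norm_sub_rev] at h5
  linarith

/-- The inverse `k` of a map that is `C¹`-close to the identity is close to the identity also in the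
Lipschitz sense. Two points of `M` are joined within `M` by the image under `r` of a segment, whose
length is at most three times their distance. -/
theorem norm_inverse_sub_id_sub_le (hh : DifferentiableOn ℝ h N) (hk : DifferentiableOn ℝ k M)
    (hkN : MapsTo k M N) (hhk : ∀ y ∈ M, h (k y) = y)
    (hd : ∀ x ∈ N, ‖derivOn (fun y => h y - y) N x‖ ≤ 1 / 100)
    (hmaps : MapsTo r U M) (hid : ∀ y ∈ M, r y = y) {B : Set E} (hB : IsOpen B) (hBc : Convex ℝ B)
    (hgood : AlmostLinearOn U r B) (hrd : ∀ x ∈ B, DifferentiableAt ℝ r x)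
    {y y' : E} (hy : y ∈ M) (hyB : y ∈ B) (hy' : y' ∈ M) (hyB' : y' ∈ B) :
    ‖(k y - y) - (k y' - y')‖ ≤ 1 / 33 * ‖y - y'‖ := by
  let σ : ℝ → E := fun s => y' + s • (y - y')
  have hσd : ∀ s, HasDerivAt σ (y - y') s := fun s =>
    (((hasDerivAt_id s).smul_const (y - y')).const_add y').congr_deriv (one_smul _ _)
  have hσB : ∀ s ∈ Icc (0 : ℝ) 1, σ s ∈ B := fun s hs => hBc.add_smul_sub_mem hyB' hyB hs
  have hγd : ∀ s ∈ Icc (0 : ℝ) 1, HasDerivAt (fun τ => r (σ τ)) (fderiv ℝ r (σ s) (y - y')) s :=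
    fun s hs => (hrd _ (hσB s hs)).hasFDerivAt.comp_hasDerivAt s (hσd s)
  have hγM : ∀ s ∈ Icc (0 : ℝ) 1, ∀ᶠ τ in 𝓝 s, r (σ τ) ∈ M := fun s hs => by
    filter_upwards [(hσd s).continuousAt.eventually_mem (hB.mem_nhds (hσB s hs))] with τ hτ
    exact hmaps (hgood.subset hτ)
  have hγn : ∀ s ∈ Icc (0 : ℝ) 1, ‖fderiv ℝ r (σ s) (y - y')‖ ≤ 3 * ‖y - y'‖ := fun s hs => by
    have : ‖fderiv ℝ r (σ s)‖ ≤ 3 := by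
      refine (hrd _ (hσB s hs)).hasFDerivAt.le_of_lip' (by norm_num) ?_
      filter_upwards [hB.mem_nhds (hσB s hs)] with x hx
      exact hgood.lipschitz x hx _ (hσB s hs)
    exact (ContinuousLinearMap.le_opNorm _ _).trans (by gcongr)
  have hex : ∀ s ∈ Icc (0 : ℝ) 1, ∃ b, HasDerivAt (fun τ => k (r (σ τ)) - r (σ τ)) b s ∧
      ‖b‖ ≤ 1 / 33 * ‖y - y'‖ := fun s hs => by
    obtain ⟨b, hb, hb'⟩ := exists_hasDerivAt_comp_inverse hh hk hkN hhk hd (hγd s hs) (hγM s hs)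
    exact ⟨_, hb.sub (hγd s hs), by linarith [hγn s hs]⟩
  choose! b hb hb' using hex
  have h01 := norm_image_sub_le_of_norm_deriv_le_segment_01'
    (fun s hs => (hb s hs).hasDerivWithinAt) (fun s hs => hb' s ⟨hs.1, hs.2.le⟩)
  simpa [σ, hid y hy, hid y' hy'] using h01

end CloseInverse

section NearIdentity

variable {n : ℕ} {M U : Set (EuclideanSpace ℝ (Fin n))}
  {r k : EuclideanSpace ℝ (Fin n) → EuclideanSpace ℝ (Fin n)} {δ : EuclideanSpace ℝ (Fin n) → ℝ}
local notation "E" => EuclideanSpace ℝ (Fin n)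

/-- `k` is close to the identity of `M` on the scale `δ` on which `r` is almost linear: it displaces
points by at most `δ / 99`, and `k - id` has Lipschitz constant `1 / 33` on balls of radius less
than `δ`. With `h - id` and its derivative bounded by `δ / 100` and `1 / 100`, inversion turns
`1 / 100` into `1 / 99`, and joining points by paths of up to three times their distance turns the
Lipschitz constant into `3 / 99`. -/
structure IsNearIdentity (M U : Set E) (r k : E → E) (δ : E → ℝ) : Prop where
  pos : ∀ x, 0 < δ x
  lip : ∀ x y, δ x ≤ δ y + ‖x - y‖
  almostLinear : ∀ z ∈ M, ∀ t < δ z, AlmostLinearOn U r (Metric.ball z t)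
  mapsTo : MapsTo r U M
  id_on : ∀ y ∈ M, r y = y
  displacement : ∀ y ∈ M, ‖k y - y‖ ≤ δ y / 99
  lipschitz : ∀ z ∈ M, ∀ t < δ z, ∀ y ∈ M, y ∈ Metric.ball z t → ∀ y' ∈ M,
    y' ∈ Metric.ball z t → ‖(k y - y) - (k y' - y')‖ ≤ 1 / 33 * ‖y - y'‖

namespace IsNearIdentity

theorem norm_sub_lt (H : IsNearIdentity M U r k δ) {z : E} {t : ℝ} (ht : δ z / 2 < t)
    {y : E} (hy : y ∈ M) (hyt : ‖y - z‖ < t / 2) : ‖k y - y‖ < t / 30 := by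
  have := H.displacement y hy
  have := H.lip y z
  linarith [H.pos z]

theorem inverse_mem_ball (H : IsNearIdentity M U r k δ) {z : E} {t : ℝ} (ht : δ z / 2 < t)
    {y : E} (hy : y ∈ M) (hyt : ‖y - z‖ < t / 2) : k y ∈ Metric.ball z t := by
  have h1 := H.norm_sub_lt ht hy hyt
  have h2 : ‖k y - z‖ ≤ ‖k y - y‖ + ‖y - z‖ := norm_sub_le_norm_sub_add_norm_sub _ _ _
  rw [mem_ball_iff_norm]
  linarith [H.pos z]

theorem inverse_mem (H : IsNearIdentity M U r k δ) {y : E} (hy : y ∈ M) : k y ∈ U := by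
  have h0 := H.pos y
  have h1 := H.inverse_mem_ball (z := y) (t := 2 / 3 * δ y) (by linarith) hy (by simp; linarith)
  exact (H.almostLinear y hy _ (by linarith)).subset h1

/-- `r ∘ k - id` has Lipschitz constant `1 / 5` on `M` near `z`. The bounds on `t` make it
comparable to `δ z` from both sides. -/
theorem norm_comp_sub_sub_le (H : IsNearIdentity M U r k δ) {z : E} (hz : z ∈ M) {t : ℝ}
    (ht : δ z / 2 < t) (ht' : t < δ z) {y y' : E} (hy : y ∈ M) (hyt : ‖y - z‖ < t / 2)
    (hy' : y' ∈ M) (hyt' : ‖y' - z‖ < t / 2) :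
    ‖r (k y) - r (k y') - (y - y')‖ ≤ 1 / 5 * ‖y - y'‖ := by
  have h0 := H.pos z
  have hg := H.almostLinear z hz t ht'
  have m1 := H.inverse_mem_ball ht hy hyt
  have m2 := H.inverse_mem_ball ht hy' hyt'
  have m3 : y ∈ Metric.ball z t := by rw [mem_ball_iff_norm]; linarith
  have m4 : y' ∈ Metric.ball z t := by rw [mem_ball_iff_norm]; linarith
  have hl := H.lipschitz z hz t ht' y hy m3 y' hy' m4
  have d1 := H.norm_sub_lt ht hy hyt
  have d2 := H.norm_sub_lt ht hy' hyt'
  have m5 : y' + (k y - k y') ∈ Metric.ball z t := by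
    rw [mem_ball_iff_norm, show y' + (k y - k y') - z = (y - z) + (k y - y) - (k y' - y') by abel]
    have e1 := norm_sub_le ((y - z) + (k y - y)) (k y' - y')
    have e2 := norm_add_le (y - z) (k y - y)
    linarith
  -- compare the increment of `r` along `k y - k y'` at `k y'` and at `y'`
  have i1 := hg.increment _ m1 _ m2 _ m5 _ m4 (by abel)
  have i2 := hg.lipschitz _ m5 _ m3
  rw [show y' + (k y - k y') - y = (k y - y) - (k y' - y') by abel, H.id_on y hy] at i2
  rw [H.id_on y' hy'] at i1
  have i3 : ‖k y - k y'‖ ≤ 34 / 33 * ‖y - y'‖ := by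
    have := norm_add_le (y - y') ((k y - y) - (k y' - y'))
    rw [show y - y' + ((k y - y) - (k y' - y')) = k y - k y' by abel] at this
    linarith
  have i4 := norm_add_le (r (k y) - r (k y') - (r (y' + (k y - k y')) - y'))
    (r (y' + (k y - k y')) - y)
  rw [show r (k y) - r (k y') - (r (y' + (k y - k y')) - y') + (r (y' + (k y - k y')) - y) =
    r (k y) - r (k y') - (y - y') by abel] at i4
  linarith [norm_nonneg (y - y')]

/-- If `r (k y) = r (k y')`, the points `y` and `y'` are close on the larger one of the two scales
`δ y` and `δ y'`, where `r ∘ k` is a small Lipschitz perturbation of the identity. -/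
theorem injOn_comp (H : IsNearIdentity M U r k δ)
    (hnear : ∀ z ∈ U, ∀ y ∈ M, ‖z - r z‖ ≤ ‖z - y‖) : InjOn (fun y => r (k y)) M := by
  have hdisp : ∀ y ∈ M, ‖r (k y) - y‖ ≤ 2 / 99 * δ y := fun y hy => by
    have h1 := hnear _ (H.inverse_mem hy) y hy
    have h2 := H.displacement y hy
    have h3 := norm_sub_le (k y - y) (k y - r (k y))
    rw [show k y - y - (k y - r (k y)) = r (k y) - y by abel] at h3
    linarith
  have key : ∀ y ∈ M, ∀ y' ∈ M, δ y' ≤ δ y → r (k y) = r (k y') → y' = y := by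
    intro y hy y' hy' hδ he
    have h0 := H.pos y
    have h1 := norm_sub_le (r (k y) - y) (r (k y') - y')
    rw [he, show r (k y') - y - (r (k y') - y') = y' - y by abel, ← he] at h1
    have h2 := hdisp y hy
    have h3 := hdisp y' hy'
    rw [← he] at h3
    have h4 := H.norm_comp_sub_sub_le hy (t := 2 / 3 * δ y) (by linarith) (by linarith) hy'
      (by linarith) hy (by simp; linarith)
    rw [he, sub_self, zero_sub, norm_neg] at h4
    have : ‖y' - y‖ ≤ 0 := by linarith
    exact sub_eq_zero.1 (norm_le_zero_iff.1 this)
  intro y hy y' hy' he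
  rcases le_total (δ y') (δ y) with hle | hle
  · exact (key y hy y' hy' hle he).symm
  · exact key y' hy' y hy hle he.symm

/-- A perturbation of the identity of a closed set is onto: near `z`, a point `y` minimizing
`‖r (k y) - z‖` would otherwise be improved by a Newton step `r (y + (z - r (k y)))`. -/
theorem surjOn_comp (H : IsNearIdentity M U r k δ) (hM : IsClosed M)
    (hcont : ContinuousOn (fun y => r (k y)) M)
    (hnear : ∀ z ∈ U, ∀ y ∈ M, ‖z - r z‖ ≤ ‖z - y‖) : SurjOn (fun y => r (k y)) M M := by
  intro z hz
  have h0 := H.pos z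
  obtain ⟨t, ht, ht'⟩ : ∃ t, δ z / 2 < t ∧ t < δ z := exists_between (by linarith)
  have hdisp : ∀ y ∈ M, ‖y - z‖ < t / 2 → ‖r (k y) - y‖ ≤ t / 15 := fun y hy hyt => by
    have h1 := hnear _ (H.inverse_mem hy) y hy
    have h2 := H.norm_sub_lt ht hy hyt
    have h3 := norm_sub_le (k y - y) (k y - r (k y))
    rw [show k y - y - (k y - r (k y)) = r (k y) - y by abel] at h3
    linarith
  have hdispz : ‖r (k z) - z‖ ≤ 2 / 99 * δ z := by
    have h1 := hnear _ (H.inverse_mem hz) z hz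
    have h2 := H.displacement z hz
    have h3 := norm_sub_le (k z - z) (k z - r (k z))
    rw [show k z - z - (k z - r (k z)) = r (k z) - z by abel] at h3
    linarith
  have hK : IsCompact (Metric.closedBall z (t / 2 * (4 / 5)) ∩ M) :=
    (isCompact_closedBall _ _).inter_right hM
  obtain ⟨y, ⟨hyb, hy⟩, hmin⟩ := hK.exists_isMinOn
    ⟨z, Metric.mem_closedBall_self (by linarith), hz⟩
    (f := fun y => ‖r (k y) - z‖) ((hcont.mono inter_subset_right).sub continuousOn_const).norm
  rw [mem_closedBall_iff_norm] at hyb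
  have hyt : ‖y - z‖ < t / 2 := by linarith
  have hgz : ‖r (k y) - z‖ ≤ 2 / 99 * δ z :=
    (hmin ⟨Metric.mem_closedBall_self (by linarith), hz⟩).trans hdispz
  have hgy := hdisp y hy hyt
  have hyz : ‖y - z‖ ≤ t / 15 + 2 / 99 * δ z := by
    have := norm_sub_le (r (k y) - z) (r (k y) - y)
    rw [show r (k y) - z - (r (k y) - y) = y - z by abel] at this
    linarith
  set w := z - r (k y) with hw
  have hwn : ‖w‖ ≤ 2 / 99 * δ z := by rw [hw, norm_sub_rev]; exact hgz
  have hg := H.almostLinear z hz t ht'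
  have m1 : y + w ∈ Metric.ball z t := by
    rw [mem_ball_iff_norm, show y + w - z = (y - z) + w by abel]
    linarith [norm_add_le (y - z) w]
  have m2 : y ∈ Metric.ball z t := by rw [mem_ball_iff_norm]; linarith
  have m3 : z ∈ Metric.ball z t := Metric.mem_ball_self (by linarith)
  have m4 : r (k y) ∈ Metric.ball z t := by rw [mem_ball_iff_norm]; linarith
  have hrk : r (k y) ∈ M := H.mapsTo (H.inverse_mem hy)
  have hy' : r (y + w) ∈ M := H.mapsTo (hg.subset m1)
  -- the Newton step `y ↦ r (y + w)` is `w` up to a small error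
  have i1 := hg.lipschitz _ m1 _ m2
  rw [add_sub_cancel_left, H.id_on y hy] at i1
  have i2 := hg.increment _ m1 _ m2 _ m3 _ m4 (by rw [hw]; abel)
  rw [add_sub_cancel_left, H.id_on y hy, H.id_on z hz, H.id_on _ hrk, ← hw] at i2
  have hyz' : ‖r (y + w) - z‖ ≤ t / 2 * (4 / 5) := by
    have := norm_add_le (r (y + w) - y) (y - z)
    rw [show r (y + w) - y + (y - z) = r (y + w) - z by abel] at this
    linarith
  have i3 := H.norm_comp_sub_sub_le hz ht ht' hy' (by linarith) hy hyt
  have i4 : ‖r (k y) - z‖ ≤ ‖r (k (r (y + w))) - z‖ := hmin ⟨mem_closedBall_iff_norm.2 hyz', hy'⟩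
  have i5 := norm_add_le (r (k (r (y + w))) - r (k y) - (r (y + w) - y)) (r (y + w) - y - w)
  rw [show r (k (r (y + w))) - r (k y) - (r (y + w) - y) + (r (y + w) - y - w) =
    r (k (r (y + w))) - z by rw [hw]; abel] at i5
  have i6 : ‖r (k y) - z‖ = ‖w‖ := by rw [hw, norm_sub_rev]
  have : ‖w‖ ≤ 0 := by linarith [norm_nonneg w]
  exact ⟨y, hy, (sub_eq_zero.1 (norm_le_zero_iff.1 this)).symm⟩

end IsNearIdentity

end NearIdentity

/-! ### The nearest point map as a diffeomorphism -/

section LocalInverse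

variable {n m m' : ℕ} {p q : WithTop ℕ∞} {A B : Set (EuclideanSpace ℝ (Fin n))}
  {f : EuclideanSpace ℝ (Fin n) → EuclideanSpace ℝ (Fin n)} {x : EuclideanSpace ℝ (Fin n)}
  {ψ : EuclideanSpace ℝ (Fin m') → EuclideanSpace ℝ (Fin n)}
  {σ : EuclideanSpace ℝ (Fin n) → EuclideanSpace ℝ (Fin m')}
  {φ : EuclideanSpace ℝ (Fin m) → EuclideanSpace ℝ (Fin n)}
  {π : EuclideanSpace ℝ (Fin n) → EuclideanSpace ℝ (Fin m)}

namespace IsLocalParam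

theorem tendsto_nhdsWithin (hA : IsLocalParam p A x ψ σ) :
    Filter.Tendsto ψ (𝓝 (σ x)) (𝓝[A] x) := by
  refine tendsto_nhdsWithin_iff.2 ⟨?_, hA.eventually_mem⟩
  have := hA.contDiffAt.continuousAt.tendsto
  rwa [hA.apply_self] at this

/-- A map expanding distances from `x` up to a constant does so in local parameters. -/
theorem exists_le_norm_sub (hp : 1 ≤ p) (hA : IsLocalParam p A x ψ σ)
    (hB : IsLocalParam p B (f x) φ π) (hf : ContinuousWithinAt f A x) (hmaps : MapsTo f A B)
    {c : ℝ} (hc : 0 < c) (hexp : ∀ᶠ x' in 𝓝[A] x, c * ‖x' - x‖ ≤ ‖f x' - f x‖) :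
    ∃ c' > 0, ∀ᶠ v in 𝓝 (σ x), c' * ‖v - σ x‖ ≤ ‖π (f (ψ v)) - π (f x)‖ := by
  obtain ⟨C, hC, s, hs, hCs⟩ := (hA.contDiffAt_left.of_le hp).exists_norm_sub_le
  obtain ⟨C', hC', s', hs', hCs'⟩ := (hB.contDiffAt.of_le hp).exists_norm_sub_le
  have hψ := hA.tendsto_nhdsWithin
  have hfψ : Filter.Tendsto (fun v => f (ψ v)) (𝓝 (σ x)) (𝓝 (f x)) := hf.tendsto.comp hψ
  have hπ : Filter.Tendsto (fun v => π (f (ψ v))) (𝓝 (σ x)) (𝓝 (π (f x))) :=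
    hB.contDiffAt_left.continuousAt.tendsto.comp hfψ
  refine ⟨c / (C * C'), by positivity, ?_⟩
  filter_upwards [hψ.eventually hexp, hA.eventually_mem, hA.eventually_left,
    (hψ.mono_right nhdsWithin_le_nhds).eventually hs, hfψ.eventually hB.eventually_right,
    hπ.eventually hs'] with v h1 h2 h3 h4 h5 h6
  have e1 := hCs _ h4 x (mem_of_mem_nhds hs)
  have e2 := hCs' _ h6 _ (mem_of_mem_nhds hs')
  rw [h3] at e1
  rw [h5 (hmaps h2), hB.apply_self] at e2
  rw [div_mul_eq_mul_div, div_le_iff₀ (by positivity)]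
  calc c * ‖v - σ x‖ ≤ c * (C * ‖ψ v - x‖) := by gcongr
    _ = C * (c * ‖ψ v - x‖) := by ring
    _ ≤ C * (C' * ‖π (f (ψ v)) - π (f x)‖) := mul_le_mul_of_nonneg_left (h1.trans e2) hC.le
    _ = _ := by ring

/-- A differentiable map that expands distances does not lower the dimension. -/
theorem dim_le (hp : 1 ≤ p) (hA : IsLocalParam p A x ψ σ)
    (hB : IsLocalParam p B (f x) φ π) (hf : DifferentiableWithinAt ℝ f A x) (hmaps : MapsTo f A B)
    {c : ℝ} (hc : 0 < c) (hexp : ∀ᶠ x' in 𝓝[A] x, c * ‖x' - x‖ ≤ ‖f x' - f x‖) : m' ≤ m := by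
  obtain ⟨c', hc', h⟩ := exists_le_norm_sub hp hA hB hf.continuousWithinAt hmaps hc hexp
  have hp0 : p ≠ 0 := ENat.one_le_iff_ne_zero_withTop.mp hp
  have hψ : HasFDerivAt ψ (fderiv ℝ ψ (σ x)) (σ x) :=
    (hA.contDiffAt.differentiableAt hp0).hasFDerivAt
  have hf' : HasFDerivWithinAt f (fderivWithin ℝ f A x) A (ψ (σ x)) := by
    rw [hA.apply_self]; exact hf.hasFDerivWithinAt
  have h1 : HasFDerivAt (f ∘ ψ) (fderivWithin ℝ f A x ∘L fderiv ℝ ψ (σ x)) (σ x) := by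
    have hmem : ψ ⁻¹' A ∈ 𝓝 (σ x) := hA.eventually_mem
    exact (hf'.comp (σ x) (hψ.hasFDerivWithinAt (s := ψ ⁻¹' A))
      (mapsTo_preimage ψ A)).hasFDerivAt hmem
  have hπ : HasFDerivAt π (fderiv ℝ π (f x)) ((f ∘ ψ) (σ x)) := by
    simp only [Function.comp_apply, hA.apply_self]
    exact (hB.contDiffAt_left.differentiableAt hp0).hasFDerivAt
  have h2 := hπ.comp (σ x) h1
  have hinj := h2.injective_of_le_norm_sub hc' (by simpa [hA.apply_self] using h)
  simpa using LinearMap.finrank_le_finrank_of_injective (f := (fderiv ℝ π (f x) ∘L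
    (fderivWithin ℝ f A x ∘L fderiv ℝ ψ (σ x))).toLinearMap) hinj

/-- A smooth distance-expanding map between submanifolds of equal dimension has local inverses,
which are as smooth as the map. -/
theorem exists_contDiffAt_rightInverse (hq : q ≠ 0) (hqp : q ≤ p) {φ : EuclideanSpace ℝ (Fin m') →
    EuclideanSpace ℝ (Fin n)} {π : EuclideanSpace ℝ (Fin n) → EuclideanSpace ℝ (Fin m')}
    (hA : IsLocalParam p A x ψ σ)
    (hB : IsLocalParam p B (f x) φ π) (hf : ContDiffAt ℝ q f x) (hmaps : MapsTo f A B)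
    {c : ℝ} (hc : 0 < c) (hexp : ∀ᶠ x' in 𝓝[A] x, c * ‖x' - x‖ ≤ ‖f x' - f x‖) :
    ∃ g, ContDiffAt ℝ q g (f x) ∧ ∀ᶠ y in 𝓝 (f x), y ∈ B → g y ∈ A ∧ f (g y) = y := by
  have hp : 1 ≤ p := (ENat.one_le_iff_ne_zero_withTop.mpr hq).trans hqp
  obtain ⟨c', hc', h⟩ :=
    exists_le_norm_sub hp hA hB hf.continuousAt.continuousWithinAt hmaps hc hexp
  have hF : ContDiffAt ℝ q (fun v => π (f (ψ v))) (σ x) := by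
    have h1 : ContDiffAt ℝ q f (ψ (σ x)) := by rwa [hA.apply_self]
    have h2 : ContDiffAt ℝ q π (f (ψ (σ x))) := by
      rw [hA.apply_self]; exact hB.contDiffAt_left.of_le hqp
    exact ContDiffAt.comp (f := fun v => f (ψ v)) (σ x) h2 (h1.comp _ (hA.contDiffAt.of_le hqp))
  have hinj := (hF.differentiableAt hq).hasFDerivAt.injective_of_le_norm_sub hc'
    (by simpa [hA.apply_self] using h)
  obtain ⟨G, hG, hG0, -, hright⟩ := hF.exists_local_inverse hq rfl hinj
  simp only [hA.apply_self] at hG hG0 hright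
  have hGπ : Filter.Tendsto (fun y => G (π y)) (𝓝 (f x)) (𝓝 (σ x)) := by
    have := hG.continuousAt.tendsto.comp hB.contDiffAt_left.continuousAt.tendsto
    rwa [hG0] at this
  have hfψ : Filter.Tendsto (fun v => f (ψ v)) (𝓝 (σ x)) (𝓝 (f x)) :=
    hf.continuousAt.tendsto.comp (hA.tendsto_nhdsWithin.mono_right nhdsWithin_le_nhds)
  refine ⟨fun y => ψ (G (π y)), ?_, ?_⟩
  · refine ContDiffAt.comp _ (g := ψ) ?_ (hG.comp _ (hB.contDiffAt_left.of_le hqp))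
    simp only [hG0]
    exact hA.contDiffAt.of_le hqp
  · filter_upwards [hGπ.eventually hA.eventually_mem,
      hB.contDiffAt_left.continuousAt.tendsto.eventually hright,
      (hfψ.comp hGπ).eventually hB.eventually_right, hB.eventually_right] with y h1 h2 h3 h4 hy
    refine ⟨h1, ?_⟩
    have h5 := h3 (hmaps h1)
    simp only [Function.comp_apply, h2] at h5
    rw [← h5, h4 hy]

end IsLocalParam

end LocalInverse

section TubularNeighborhood

variable {n : ℕ} {M N U : Set (EuclideanSpace ℝ (Fin n))}
  {r h k : EuclideanSpace ℝ (Fin n) → EuclideanSpace ℝ (Fin n)}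
  {δ : EuclideanSpace ℝ (Fin n) → ℝ} {p q : WithTop ℕ∞}
local notation "E" => EuclideanSpace ℝ (Fin n)

theorem AlmostLinearOn.contDiffAt {B : Set E} (hgood : AlmostLinearOn U r B) (hq : q ≠ 0)
    (hpq : q + 1 ≤ p) (hM : IsSubmanifold p M) (hmaps : MapsTo r U M)
    (hnear : ∀ z ∈ U, ∀ y ∈ M, ‖z - r z‖ ≤ ‖z - y‖) {x : E} (hB : B ∈ 𝓝 x) :
    ContDiffAt ℝ q r x := by
  have hr : ContinuousAt r x := by
    have hL : LipschitzOnWith 3 r B := LipschitzOnWith.of_dist_le_mul fun x hx y hy => by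
      simpa [dist_eq_norm] using hgood.lipschitz x hx y hy
    exact hL.continuousOn.continuousAt hB
  have hmB := hmaps.mono_left hgood.subset
  have hnB : ∀ z ∈ B, ∀ y ∈ M, ‖z - r z‖ ≤ ‖z - y‖ := fun z hz => hnear z (hgood.subset hz)
  exact contDiffAt_nearestPoint hq hpq hM hB hr hmB hnB (by norm_num)
    (quadratic_growth_of_lipschitz hB hmB hnB hgood.lipschitz)

theorem exists_almostLinearOn_ball (hM : IsSubmanifold 2 M) (hmaps : MapsTo r U M)
    (hcont : ContinuousOn r U) (hid : ∀ y ∈ M, r y = y)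
    (hnear : ∀ z ∈ U, ∀ y ∈ M, ‖z - r z‖ ≤ ‖z - y‖) {x : E} (hx : x ∈ M) (hU : U ∈ 𝓝 x) :
    ∃ t > 0, AlmostLinearOn U r (Metric.ball x t) := by
  have hrC : ContDiffAt ℝ 1 r x := by
    refine contDiffAt_nearestPoint one_ne_zero (by norm_num) hM hU (hcont.continuousAt hU) hmaps
      hnear one_pos (Filter.Eventually.of_forall fun z _ => ?_)
    rw [hid x hx, norm_sub_rev z x]; simp
  have hstrict := hrC.hasStrictFDerivAt one_ne_zero
  have hnorm : ‖fderiv ℝ r x‖ ≤ 2 := by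
    refine hstrict.hasFDerivAt.le_of_lip' (by norm_num) ?_
    filter_upwards [hU] with z hz
    have h1 := hnear z hz x hx
    have h2 := norm_sub_le (z - x) (z - r z)
    rw [show z - x - (z - r z) = r z - x by abel] at h2
    rw [hid x hx]; linarith
  obtain ⟨s, hs, happ⟩ := hstrict.approximates_deriv_on_nhds (c := 1 / 20) (Or.inr (by norm_num))
  obtain ⟨t, ht, hts⟩ := Metric.mem_nhds_iff.1 (Filter.inter_mem hs hU)
  refine ⟨t, ht, fun z hz => (hts hz).2, fun y hy z hz => ?_, fun a ha b hb a' ha' b' hb' he => ?_⟩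
  · have h1 := happ _ (hts hy).1 _ (hts hz).1
    have h2 := (fderiv ℝ r x).le_of_opNorm_le hnorm (y - z)
    have h3 := norm_le_norm_add_norm_sub' (r y - r z) (fderiv ℝ r x (y - z))
    push_cast at h1
    linarith [norm_nonneg (y - z)]
  · have h1 := happ _ (hts ha).1 _ (hts hb).1
    have h2 := happ _ (hts ha').1 _ (hts hb').1
    have h3 := norm_sub_le (r a - r b - fderiv ℝ r x (a - b))
      (r a' - r b' - fderiv ℝ r x (a' - b'))
    rw [← he] at h2 h3
    rw [sub_sub_sub_cancel_right] at h3
    push_cast at h1 h2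
    linarith

theorem OMinimalStructure.IsTubularNeighborhood.norm_sub_le {D : OMinimalStructure}
    (hU : D.IsTubularNeighborhood M U r) : ∀ z ∈ U, ∀ y ∈ M, ‖z - r z‖ ≤ ‖z - y‖ := by
  intro z hz y hy
  rcases eq_or_ne y (r z) with rfl | hne
  · exact le_rfl
  · simpa [dist_eq_norm] using (hU.nearest z hz y hy hne).le

theorem OMinimalStructure.IsDefinableMapOn.mono {D : OMinimalStructure}
    (hr : D.IsDefinableMapOn r U) (hN : D.IsDefinable N) (hNU : N ⊆ U) :
    D.IsDefinableMapOn r N := by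
  have h := D.inter_mem hr (D.prod_mem n n _ univ hN (D.univ_mem n))
  unfold OMinimalStructure.IsDefinableMapOn
  convert h using 1
  ext z
  simp only [mem_ofPred_eq, mem_inter_iff, mem_univ, and_true]
  constructor
  · rintro ⟨x, hx, rfl⟩
    exact ⟨⟨x, hNU hx, rfl⟩, by simpa using hx⟩
  · rintro ⟨⟨x, hx, rfl⟩, hxN⟩
    exact ⟨x, by simpa using hxN, rfl⟩

/-- If `k` is close to the identity and is inverse to a map `h : N → M`, the nearest point map
restricts to a diffeomorphism `N → M`, as smooth as the submanifolds permit. -/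
theorem IsNearIdentity.isDiffeo (H : IsNearIdentity M U r k δ) (hMc : IsClosed M) (hq : q ≠ 0)
    (hpq : q + 1 ≤ p) (hM : IsSubmanifold p M) (hN : IsSubmanifold p N)
    (hnear : ∀ z ∈ U, ∀ y ∈ M, ‖z - r z‖ ≤ ‖z - y‖)
    (hh : DifferentiableOn ℝ h N) (hhM : MapsTo h N M) (hk : DifferentiableOn ℝ k M)
    (hkN : MapsTo k M N) (hkh : LeftInvOn k h N) (hhk : ∀ y ∈ M, h (k y) = y) :
    IsDiffeo q r N M := by
  have hp1 : 1 ≤ p := (ENat.one_le_iff_ne_zero_withTop.mpr hq).trans (le_self_add.trans hpq)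
  have hrC : ∀ y ∈ M, ContDiffAt ℝ q r (k y) := fun y hy => by
    have h0 := H.pos y
    exact (H.almostLinear y hy (2 / 3 * δ y) (by linarith)).contDiffAt hq hpq hM H.mapsTo hnear
      (Metric.isOpen_ball.mem_nhds (H.inverse_mem_ball (by linarith) hy (by simp; linarith)))
  have hinj := H.injOn_comp hnear
  have hsurj := H.surjOn_comp hMc (fun y hy => (hrC y hy).continuousAt.comp_continuousWithinAt
    (hk y hy).continuousWithinAt) hnear
  have hbij : BijOn r N M := by
    refine ⟨fun x hx => ?_, fun x hx x' hx' he => ?_, fun y hy => ?_⟩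
    · rw [← hkh hx]
      exact H.mapsTo (H.inverse_mem (hhM hx))
    · rw [← hkh hx, ← hkh hx'] at he
      rw [← hkh hx, ← hkh hx', hinj (hhM hx) (hhM hx') he]
    · obtain ⟨z, hz, rfl⟩ := hsurj hy
      exact ⟨k z, hkN hz, rfl⟩
  refine ⟨hbij, fun x hx => ?_, Function.invFunOn r N, fun y hy => ?_,
    hbij.injOn.leftInvOn_invFunOn⟩
  · rw [← hkh hx]
    exact (hrC _ (hhM hx)).contDiffWithinAt
  obtain ⟨z, hz, rfl⟩ := hsurj hy
  have h0 := H.pos z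
  obtain ⟨t, ht, ht'⟩ : ∃ t, δ z / 2 < t ∧ t < δ z := exists_between (by linarith)
  have hball : ∀ᶠ y in 𝓝 z, ‖y - z‖ < t / 2 := by
    filter_upwards [Metric.ball_mem_nhds z (by linarith : 0 < t / 2)] with y hy
    rwa [mem_ball_iff_norm] at hy
  have hk2 : ∀ y ∈ M, ‖y - z‖ < t / 2 → ‖(k y - z) - (k z - z) - (y - z)‖ ≤ 1 / 33 * ‖y - z‖ := by
    intro y hy hyt
    have := H.lipschitz z hz t ht' y hy (by rw [mem_ball_iff_norm]; linarith) z hz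
      (Metric.mem_ball_self (by linarith))
    rwa [show k y - y - (k z - z) = (k y - z) - (k z - z) - (y - z) by abel] at this
  have hklow : ∀ y ∈ M, ‖y - z‖ < t / 2 → 32 / 33 * ‖y - z‖ ≤ ‖k y - k z‖ := by
    intro y hy hyt
    have h1 := hk2 y hy hyt
    rw [sub_sub_sub_cancel_right] at h1
    have h2 := norm_sub_norm_le (y - z) (k y - k z)
    rw [norm_sub_rev (y - z)] at h2
    linarith
  have hkup : ∀ y ∈ M, ‖y - z‖ < t / 2 → ‖k y - k z‖ ≤ 34 / 33 * ‖y - z‖ := by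
    intro y hy hyt
    have h1 := hk2 y hy hyt
    rw [sub_sub_sub_cancel_right] at h1
    have h2 := norm_le_norm_add_norm_sub' (k y - k z) (y - z)
    linarith
  have hgup : ∀ y ∈ M, ‖y - z‖ < t / 2 → 4 / 5 * ‖y - z‖ ≤ ‖r (k y) - r (k z)‖ := by
    intro y hy hyt
    have h1 := H.norm_comp_sub_sub_le hz ht ht' hy hyt hz (by simp; linarith)
    have h2 := norm_sub_norm_le (y - z) (r (k y) - r (k z))
    rw [norm_sub_rev (y - z)] at h2
    linarith
  have hhc : Filter.Tendsto h (𝓝[N] (k z)) (𝓝 z) := by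
    have := (hh _ (hkN hz)).continuousWithinAt.tendsto
    rwa [hhk z hz] at this
  obtain ⟨m, hMm⟩ := hM.exists_isLocalParam
  obtain ⟨m', hNm'⟩ := hN.exists_isLocalParam
  obtain ⟨φ', π', hφ'⟩ := hMm z hz
  obtain ⟨φ, π, hφ⟩ := hMm _ (H.mapsTo (H.inverse_mem hz))
  obtain ⟨ψ, σ, hψ⟩ := hNm' _ (hkN hz)
  have hhexp : ∀ᶠ x in 𝓝[N] (k z), 33 / 34 * ‖x - k z‖ ≤ ‖h x - h (k z)‖ := by
    filter_upwards [hhc.eventually hball, self_mem_nhdsWithin] with x hx hxN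
    have := hkup _ (hhM hxN) hx
    rw [hkh hxN] at this
    rw [hhk z hz]; linarith
  have hrexp : ∀ᶠ x in 𝓝[N] (k z), 1 / 2 * ‖x - k z‖ ≤ ‖r x - r (k z)‖ := by
    filter_upwards [hhc.eventually hball, self_mem_nhdsWithin] with x hx hxN
    have h1 := hkup _ (hhM hxN) hx
    have h2 := hgup _ (hhM hxN) hx
    rw [hkh hxN] at h1 h2
    linarith [norm_nonneg (h x - z)]
  have hkexp : ∀ᶠ y in 𝓝[M] z, 32 / 33 * ‖y - z‖ ≤ ‖k y - k z‖ := by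
    filter_upwards [hball.filter_mono nhdsWithin_le_nhds, self_mem_nhdsWithin] with y hy hyM
    exact hklow y hyM hy
  -- `h` and `k` expand distances up to constants, so the dimensions agree
  have hdim : m = m' := by
    refine le_antisymm (hφ'.dim_le hp1 hψ (hk z hz) hkN (by norm_num) hkexp) ?_
    refine hψ.dim_le hp1 (f := h) (φ := φ') (π := π') ?_ (hh _ (hkN hz)) hhM (by norm_num) hhexp
    rwa [hhk z hz]
  subst hdim
  obtain ⟨g, hg, hgr⟩ := hψ.exists_contDiffAt_rightInverse hq (le_self_add.trans hpq) hφ (hrC z hz)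
    hbij.mapsTo (by norm_num) hrexp
  refine hg.contDiffWithinAt.congr_of_eventuallyEq_of_mem ?_ hy
  filter_upwards [hgr.filter_mono nhdsWithin_le_nhds, self_mem_nhdsWithin] with y hy hyM
  obtain ⟨hgN, hgy⟩ := hy hyM
  have := hbij.injOn.leftInvOn_invFunOn hgN
  rwa [hgy] at this

end TubularNeighborhood

theorem theorem2p1 (D : OMinimalStructure) (n : ℕ)
    (M U : Set (EuclideanSpace ℝ (Fin n)))
    (r : EuclideanSpace ℝ (Fin n) → EuclideanSpace ℝ (Fin n))
    (hMdef : D.IsDefinable M) (hMclosed : IsClosed M) (hM : IsSubmanifold 2 M)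
    (hU : D.IsTubularNeighborhood M U r) :
    ∃ ε ∈ D.posFun (Set.univ : Set (EuclideanSpace ℝ (Fin n))),
      ∀ N : Set (EuclideanSpace ℝ (Fin n)), D.IsDefinable N → IsSubmanifold 2 N →
        ∀ h : EuclideanSpace ℝ (Fin n) → EuclideanSpace ℝ (Fin n), IsDiffeo 1 h N M →
          (∀ x ∈ N, c1Size (fun y => h y - y) N x < ε x) →
            N ⊆ U ∧ D.IsDefinableMapOn r N ∧ IsDiffeo 1 r N M ∧
              (IsSubmanifold ∞ M → IsSubmanifold ∞ N → IsDiffeo ∞ r N M) := by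
  have hnear := hU.norm_sub_le
  obtain ⟨δ, hpos, hle1, hlip, hδdef, hgood⟩ := OMinimalStructure.exists_definable_radius
    (G := AlmostLinearOn U r) (fun A B hB hAB => hB.mono hAB)
    (OMinimalStructure.definableSet_almostLinearOn_ball hU.definable_nhd hU.definable_map)
    hMdef hMclosed fun p hp => exists_almostLinearOn_ball hM hU.mapsTo hU.continuousOn hU.id_on
      hnear hp (mem_nhdsSet_iff_forall.1 hU.mem_nhdsSet p hp)
  refine ⟨fun x => δ x / 100, ⟨fun x _ => div_pos (hpos x) (by norm_num), ?_, ?_⟩, ?_⟩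
  · have : LipschitzWith 1 δ := LipschitzWith.of_le_add fun x y => by
      simpa [dist_eq_norm] using hlip x y
    exact (this.continuous.div_const 100).continuousOn
  · have h1 := hδdef.preimage (f := fun z : Fin (n + 1) → ℝ =>
      ((WithLp.toLp 2 fun i => z (Fin.castAdd 1 i) : EuclideanSpace ℝ (Fin n)),
        100 * z (Fin.natAdd n 0))) ⟨fun x y => by ext <;> simp [mul_add],
          fun c x => by ext <;> simp [mul_left_comm]⟩
    convert h1 (n + 1) LinearMap.id using 1
    ext z
    simp only [mem_ofPred_eq, mem_univ, true_and, mem_preimage, LinearMap.id_apply]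
    constructor
    · rintro ⟨x, rfl⟩
      simp
      ring
    · intro hz
      refine ⟨WithLp.toLp 2 fun i => z (Fin.castAdd 1 i), ?_⟩
      ext i
      refine Fin.addCases (fun i => ?_) (fun i => ?_) i
      · simp
      · rw [Fin.append_right, ← hz, Subsingleton.elim i 0]; ring
  intro N hNdef hN h hh hsize
  obtain ⟨hbij, hhC, k, hkC, hkh⟩ := hh
  have hkN : MapsTo k M N := fun y hy => by
    obtain ⟨x, hx, rfl⟩ := hbij.surjOn hy
    rwa [hkh hx]
  have hhk : ∀ y ∈ M, h (k y) = y := fun y hy => by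
    obtain ⟨x, hx, rfl⟩ := hbij.surjOn hy
    rw [hkh hx]
  have hhd := hhC.differentiableOn one_ne_zero
  have hkd := hkC.differentiableOn one_ne_zero
  have hderiv : ∀ x ∈ N, ‖derivOn (fun y => h y - y) N x‖ ≤ 1 / 100 := fun x hx => by
    have h1 := hsize x hx
    rw [c1Size] at h1
    linarith [norm_nonneg (h x - x), hle1 x]
  have H : IsNearIdentity M U r k δ :=
    { pos := hpos
      lip := hlip
      almostLinear := hgood
      mapsTo := hU.mapsTo
      id_on := hU.id_on
      displacement := fun y hy => by
        have h1 := hsize (k y) (hkN hy)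
        rw [c1Size, hhk y hy, norm_sub_rev] at h1
        linarith [norm_nonneg (derivOn (fun y => h y - y) N (k y)), hlip (k y) y]
      lipschitz := fun z hz t ht y hy hyt y' hy' hyt' =>
        norm_inverse_sub_id_sub_le hhd hkd hkN hhk hderiv hU.mapsTo hU.id_on Metric.isOpen_ball
          (convex_ball z t) (hgood z hz t ht)
          (fun x hx => ((hgood z hz t ht).contDiffAt one_ne_zero (by norm_num) hM hU.mapsTo hnear
            (Metric.isOpen_ball.mem_nhds hx)).differentiableAt one_ne_zero) hy hyt hy' hyt' }
  have hNU : N ⊆ U := fun x hx => by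
    rw [← hkh hx]
    exact H.inverse_mem (hbij.mapsTo hx)
  exact ⟨hNU, hU.definable_map.mono hNdef hNU,
    H.isDiffeo hMclosed one_ne_zero (by norm_num) hM hN hnear hhd hbij.mapsTo hkd hkN hkh hhk,
    fun hM' hN' => H.isDiffeo hMclosed (by decide) (by simp) hM' hN' hnear hhd hbij.mapsTo hkd hkN
      hkh hhk⟩
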